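/- Let $0<q<1$ and let $\mathcal O(SU_q(2))$ be the unital complex $*$-algebra generated by $a,b,c,d$ with relations $ab=qba$, $ac=qca$, $bd=qdb$, $cd=qdc$, $bc=cb$, $ad-qbc=1=da-q^{-1}bc$, involution $a^*=d$, $b^*=-qc$, $c^*=-q^{-1}b$, $d^*=a$, and the comultiplication $\Delta$ for which $\begin{pmatrix}a&b\\c&d\end{pmatrix}$ is a matrix corepresentation. Let $h$ be its Haar functional ($h(1)=1$, $(\mathrm{id}\otimes h)\Delta f=h(f)1=(h\otimes \mathrm{id})\Delta f$), and let $H$ be the completion of $\mathcal O(SU_q(2))$ for the inner product $\langle y,x\rangle=h(xy^*)$. For $l\in\frac12\mathbb N=\{0,\frac12,1,\dots\}$ let $T^{(l)}=(t^l_{ij})_{-l\le i,j\le l}$ be the irreducible unitary matrix corepresentation on the homogeneous polynomials of degree $2l$ in the quantum plane $xy=qyx$, with coaction $x\mapsto x\otimes a+y\otimes c$, $y\mapsto x\otimes b+y\otimes d$, in the normalized basis $\binom{2l}{l+i}_{q^{-2}}^{1/2}x^{l-i}y^{l+i}$. For $f\in H$ let $\hat f(l)_{mn}=\langle t^l_{nm},f\rangle$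 (that is, $h(f(t^l_{nm})^*)$), and write $[n]_q=\frac{q^n-q^{-n}}{q-q^{-1}}$ and $\mathrm{Tr}_q(A)=\sum_{j=-l}^{l}q^{-2j}A_{jj}$. A symbol $\sigma$ assigns to each $l\in\frac12\mathbb N$ a matrix $\sigma(l)$ of size $2l+1$, indexed by $-l,\dots,l$, with entries in $\mathcal O(SU_q(2))$. Its global pseudo-differential operator is $$T_\sigma f=\sum_{l\in\frac12\mathbb N}[2l+1]_q\,\mathrm{Tr}_q\big(\sigma(l)\,\hat f(l)\,T^{(l)}\big),$$ i.e. the inverse Fourier transform of $\sigma\hat f$, a possibly unbounded operator in $H$ whose domain consists of all $f\in H$ for which the series converges unconditionally in $H$. For $m\in\frac12\mathbb N$, a symbol is homogeneous of Fourier order $m$ if there are maps $\psi(l)$ from pairs of indices in $\{-l,\dots,l\}$ to pairs of half-integers such that $\sigma(l)_{ij}\in\mathbb C\,t^m_{\psi(l)(i,j)}$ if both components of $\psi(l)(i,j)$ lie in $\{-m,-m+1,\dots,m\}$, and $\sigma(l)_{ij}=0$ otherwise; $\Phi^m(SU_q(2))$ is the linear span of these symbols (so $\Phi^0$ consists of the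 symbols with scalar entries). **Theorem.** Let $\lambda:\frac12\mathbb N\to\mathbb C$ and let $\sigma\in\Phi^0(SU_q(2))$ satisfy $\sum_{j}\sigma_{i_0j}(l)=\lambda(l)$ for all $l\in\frac12\mathbb N$ and all $-l\le i_0\le l$. Then $\lambda(l)$ belongs to the spectrum of $T_\sigma$ for every $l\in\frac12\mathbb N$. Furthermore, the multiplicity of $\lambda(l)$ is at least $2l+1$: $\dim\ker(T_\sigma-\lambda(l))\ge 2l+1$. -/

import Mathlib

open scoped TensorProduct ComplexConjugate

namespace SUq2

/-- The deformation parameter: a real number `0 < q < 1`. -/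
abbrev Param : Type := Set.Ioo (0 : ℝ) 1

theorem Param.ne_zero (q : Param) : ((q : ℝ) : ℂ) ≠ 0 := by
  exact_mod_cast q.2.1.ne'

/-- The four generators of the coordinate algebra. -/
inductive Gen
  | a | b | c | d

open FreeAlgebra in
/-- The defining relations of `SU_q(2)`. -/
inductive Rel (q : Param) : FreeAlgebra ℂ Gen → FreeAlgebra ℂ Gen → Prop
  | ab : Rel q (ι ℂ Gen.a * ι ℂ Gen.b) (((q : ℝ) : ℂ) • (ι ℂ Gen.b * ι ℂ Gen.a))
  | ac : Rel q (ι ℂ Gen.a * ι ℂ Gen.c) (((q : ℝ) : ℂ) • (ι ℂ Gen.c * ι ℂ Gen.a))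
  | bd : Rel q (ι ℂ Gen.b * ι ℂ Gen.d) (((q : ℝ) : ℂ) • (ι ℂ Gen.d * ι ℂ Gen.b))
  | cd : Rel q (ι ℂ Gen.c * ι ℂ Gen.d) (((q : ℝ) : ℂ) • (ι ℂ Gen.d * ι ℂ Gen.c))
  | bc : Rel q (ι ℂ Gen.b * ι ℂ Gen.c) (ι ℂ Gen.c * ι ℂ Gen.b)
  | ad : Rel q (ι ℂ Gen.a * ι ℂ Gen.d - ((q : ℝ) : ℂ) • (ι ℂ Gen.b * ι ℂ Gen.c)) 1
  | da : Rel q (ι ℂ Gen.d * ι ℂ Gen.a - ((q : ℝ) : ℂ)⁻¹ • (ι ℂ Gen.b * ι ℂ Gen.c)) 1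

/-- The coordinate algebra of `SU_q(2)`: the complex unital algebra with generators `a, b, c, d`
and the relations `Rel`. -/
def Coord (q : Param) : Type := RingQuot (Rel q)

noncomputable instance (q : Param) : Ring (Coord q) := inferInstanceAs (Ring (RingQuot (Rel q)))

noncomputable instance (q : Param) : Algebra ℂ (Coord q) :=
  inferInstanceAs (Algebra ℂ (RingQuot (Rel q)))

/-- The class of a generator. -/
noncomputable def gen (q : Param) (x : Gen) : Coord q :=
  RingQuot.mkAlgHom ℂ (Rel q) (FreeAlgebra.ι ℂ x)

section Relations
variable (q : Param)

theorem gen_ab : gen q .a * gen q .b = ((q : ℝ) : ℂ) • (gen q .b * gen q .a) := by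
  have := RingQuot.mkAlgHom_rel ℂ (Rel.ab (q := q))
  rw [map_smul, map_mul, map_mul] at this
  exact this
theorem gen_ac : gen q .a * gen q .c = ((q : ℝ) : ℂ) • (gen q .c * gen q .a) := by
  have := RingQuot.mkAlgHom_rel ℂ (Rel.ac (q := q))
  rw [map_smul, map_mul, map_mul] at this
  exact this
theorem gen_bd : gen q .b * gen q .d = ((q : ℝ) : ℂ) • (gen q .d * gen q .b) := by
  have := RingQuot.mkAlgHom_rel ℂ (Rel.bd (q := q))
  rw [map_smul, map_mul, map_mul] at this
  exact this
theorem gen_cd : gen q .c * gen q .d = ((q : ℝ) : ℂ) • (gen q .d * gen q .c) := by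
  have := RingQuot.mkAlgHom_rel ℂ (Rel.cd (q := q))
  rw [map_smul, map_mul, map_mul] at this
  exact this
theorem gen_bc : gen q .b * gen q .c = gen q .c * gen q .b := by
  have := RingQuot.mkAlgHom_rel ℂ (Rel.bc (q := q))
  rw [map_mul, map_mul] at this
  exact this
theorem gen_ad : gen q .a * gen q .d = 1 + ((q : ℝ) : ℂ) • (gen q .b * gen q .c) := by
  have := RingQuot.mkAlgHom_rel ℂ (Rel.ad (q := q))
  rw [map_sub, map_smul, map_mul, map_mul, map_one] at this
  exact sub_eq_iff_eq_add.1 this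
theorem gen_da : gen q .d * gen q .a = 1 + ((q : ℝ) : ℂ)⁻¹ • (gen q .b * gen q .c) := by
  have := RingQuot.mkAlgHom_rel ℂ (Rel.da (q := q))
  rw [map_sub, map_smul, map_mul, map_mul, map_one] at this
  exact sub_eq_iff_eq_add.1 this

end Relations

/-- The relations of `SU_q(2)` for a family of elements of an algebra. -/
structure Satisfies (q : Param) {B : Type*} [Ring B] [Algebra ℂ B] (g : Gen → B) : Prop where
  ab : g .a * g .b = ((q : ℝ) : ℂ) • (g .b * g .a)
  ac : g .a * g .c = ((q : ℝ) : ℂ) • (g .c * g .a)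
  bd : g .b * g .d = ((q : ℝ) : ℂ) • (g .d * g .b)
  cd : g .c * g .d = ((q : ℝ) : ℂ) • (g .d * g .c)
  bc : g .b * g .c = g .c * g .b
  ad : g .a * g .d = 1 + ((q : ℝ) : ℂ) • (g .b * g .c)
  da : g .d * g .a = 1 + ((q : ℝ) : ℂ)⁻¹ • (g .b * g .c)

/-- The universal property of the coordinate algebra. -/
noncomputable def lift (q : Param) {B : Type*} [Ring B] [Algebra ℂ B] (g : Gen → B)
    (hg : Satisfies q g) : Coord q →ₐ[ℂ] B :=
  RingQuot.liftAlgHom ℂ ⟨FreeAlgebra.lift ℂ g, by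
    rintro _ _ (_ | _ | _ | _ | _ | _ | _)
    · simp only [map_mul, map_smul, FreeAlgebra.lift_ι_apply, hg.ab]
    · simp only [map_mul, map_smul, FreeAlgebra.lift_ι_apply, hg.ac]
    · simp only [map_mul, map_smul, FreeAlgebra.lift_ι_apply, hg.bd]
    · simp only [map_mul, map_smul, FreeAlgebra.lift_ι_apply, hg.cd]
    · simp only [map_mul, FreeAlgebra.lift_ι_apply, hg.bc]
    · simp only [map_sub, map_mul, map_smul, map_one, FreeAlgebra.lift_ι_apply, hg.ad,
        add_sub_cancel_right]
    · simp only [map_sub, map_mul, map_smul, map_one, FreeAlgebra.lift_ι_apply, hg.da,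
        add_sub_cancel_right]⟩

@[simp] theorem lift_gen (q : Param) {B : Type*} [Ring B] [Algebra ℂ B] (g : Gen → B)
    (hg : Satisfies q g) (x : Gen) : lift q g hg (gen q x) = g x := by
  unfold lift gen
  exact (RingQuot.liftAlgHom_mkAlgHom_apply ℂ _ _ _).trans (FreeAlgebra.lift_ι_apply _ _)

theorem Coord.induction {q : Param} {P : Coord q → Prop}
    (hC : ∀ z : ℂ, P (algebraMap ℂ _ z)) (hg : ∀ x, P (gen q x))
    (hadd : ∀ f g, P f → P g → P (f + g)) (hmul : ∀ f g, P f → P g → P (f * g))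
    (f : Coord q) : P f := by
  obtain ⟨f, rfl⟩ := RingQuot.mkAlgHom_surjective ℂ (Rel q) f
  induction f using FreeAlgebra.induction with
  | grade0 z => rw [AlgHom.commutes]; exact hC z
  | grade1 x => exact hg x
  | mul f g hf hg' => rw [map_mul]; exact hmul _ _ hf hg'
  | add f g hf hg' => rw [map_add]; exact hadd _ _ hf hg'

/-! The involution: the conjugate-linear anti-multiplicative map with
`a* = d`, `b* = -q c`, `c* = -q⁻¹ b`, `d* = a`. -/

/-- The opposite algebra, with scalars acting through complex conjugation. -/
def ConjOp (q : Param) : Type := (Coord q)ᵐᵒᵖ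

noncomputable instance (q : Param) : Ring (ConjOp q) := inferInstanceAs (Ring (Coord q)ᵐᵒᵖ)

noncomputable instance (q : Param) : Algebra ℂ (ConjOp q) :=
  ((algebraMap ℂ (Coord q)ᵐᵒᵖ).comp (starRingEnd ℂ)).toAlgebra' fun z x =>
    Algebra.commutes (A := (Coord q)ᵐᵒᵖ) (conj z) x

/-- Identity map to `ConjOp`. -/
def toConjOp {q : Param} (f : Coord q) : ConjOp q := MulOpposite.op f

/-- Identity map from `ConjOp`. -/
def ofConjOp {q : Param} (f : ConjOp q) : Coord q := MulOpposite.unop f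

theorem ofConjOp_toConjOp {q : Param} (f : Coord q) : ofConjOp (toConjOp f) = f := rfl
theorem ofConjOp_injective {q : Param} : Function.Injective (ofConjOp (q := q)) :=
  MulOpposite.unop_injective
theorem ofConjOp_mul {q : Param} (f g : ConjOp q) : ofConjOp (f * g) = ofConjOp g * ofConjOp f :=
  rfl
theorem ofConjOp_add {q : Param} (f g : ConjOp q) : ofConjOp (f + g) = ofConjOp f + ofConjOp g :=
  rfl
theorem ofConjOp_one {q : Param} : ofConjOp (1 : ConjOp q) = 1 := rfl
theorem ofConjOp_algebraMap {q : Param} (z : ℂ) :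
    ofConjOp (algebraMap ℂ (ConjOp q) z) = algebraMap ℂ (Coord q) (conj z) := rfl
theorem ofConjOp_smul {q : Param} (z : ℂ) (f : ConjOp q) :
    ofConjOp (z • f) = conj z • ofConjOp f := by
  rw [Algebra.smul_def, ofConjOp_mul, ofConjOp_algebraMap, ← Algebra.commutes, Algebra.smul_def]

/-- The adjoints of the generators. -/
noncomputable def genStar (q : Param) : Gen → Coord q
  | .a => gen q .d
  | .b => -((q : ℝ) : ℂ) • gen q .c
  | .c => -((q : ℝ) : ℂ)⁻¹ • gen q .b
  | .d => gen q .a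

/-- The involution, as a homomorphism to `ConjOp`. -/
noncomputable def starHom (q : Param) : Coord q →ₐ[ℂ] ConjOp q :=
  lift q (fun x => toConjOp (genStar q x)) <| by
    have h0 := Param.ne_zero q
    constructor <;> apply ofConjOp_injective <;>
      simp only [ofConjOp_smul, ofConjOp_mul, ofConjOp_add, ofConjOp_toConjOp, ofConjOp_one,
        genStar, smul_mul_assoc, mul_smul_comm, Complex.conj_ofReal, map_inv₀]
    · rw [gen_cd]; module
    · rw [gen_bd]; module
    · rw [gen_ac]; module
    · rw [gen_ab]; module
    · rw [gen_bc]; module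
    · rw [gen_ad, gen_bc]; match_scalars <;> field_simp
    · rw [gen_da, gen_bc]; match_scalars <;> field_simp

noncomputable instance (q : Param) : Star (Coord q) := ⟨fun f => ofConjOp (starHom q f)⟩

theorem star_def {q : Param} (f : Coord q) : star f = ofConjOp (starHom q f) := rfl

theorem star_gen (q : Param) (x : Gen) : star (gen q x) = genStar q x := by
  rw [star_def, starHom, lift_gen]; rfl

theorem star_algebraMap {q : Param} (z : ℂ) :
    star (algebraMap ℂ (Coord q) z) = algebraMap ℂ (Coord q) (conj z) := by
  rw [star_def, AlgHom.commutes]; rfl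

theorem star_smul' {q : Param} (z : ℂ) (f : Coord q) : star (z • f) = conj z • star f := by
  rw [star_def, map_smul, ofConjOp_smul]; rfl

noncomputable instance (q : Param) : StarRing (Coord q) where
  star_mul f g := by rw [star_def, map_mul]; rfl
  star_add f g := by rw [star_def, map_add]; rfl
  star_involutive f := by
    have hmul : ∀ f g : Coord q, star (f * g) = star g * star f := fun f g => by
      rw [star_def, map_mul]; rfl
    have hadd : ∀ f g : Coord q, star (f + g) = star f + star g := fun f g => by
      rw [star_def, map_add]; rfl
    have h0 := Param.ne_zero q
    induction f using Coord.induction with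
    | hC z => simp [star_algebraMap]
    | hg x =>
      have hneg : ∀ (z : ℂ) (x : Gen), star (-z • gen q x) = conj (-z) • genStar q x := fun z x => by
        rw [star_smul', star_gen]
      cases x <;> simp only [star_gen, genStar, hneg] <;>
        simp only [map_neg, map_inv₀, Complex.conj_ofReal, smul_smul] <;>
        match_scalars <;> field_simp
    | hadd f g hf hg => rw [hadd, hadd, hf, hg]
    | hmul f g hf hg => rw [hmul, hmul, hf, hg]

instance (q : Param) : StarModule ℂ (Coord q) := ⟨fun z f => star_smul' z f⟩

/-- The comultiplication, `Δ(t) = t ⊗ t` for the matrix `t = (a b; c d)`. -/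
noncomputable def comul (q : Param) : Coord q →ₐ[ℂ] Coord q ⊗[ℂ] Coord q :=
  lift q (fun
    | .a => gen q .a ⊗ₜ gen q .a + gen q .b ⊗ₜ gen q .c
    | .b => gen q .a ⊗ₜ gen q .b + gen q .b ⊗ₜ gen q .d
    | .c => gen q .c ⊗ₜ gen q .a + gen q .d ⊗ₜ gen q .c
    | .d => gen q .c ⊗ₜ gen q .b + gen q .d ⊗ₜ gen q .d) <| by
    have h0 := Param.ne_zero q
    constructor <;>
      simp only [mul_add, add_mul, Algebra.TensorProduct.tmul_mul_tmul, gen_ab, gen_ac, gen_bd,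
        gen_cd, gen_ad, gen_da, gen_bc, TensorProduct.tmul_add, TensorProduct.add_tmul,
        TensorProduct.tmul_smul, ← TensorProduct.smul_tmul', smul_add, smul_smul,
        Algebra.TensorProduct.one_def] <;>
      match_scalars <;> (try field_simp)



/-! The Haar state, through the faithful representation on the basis `e (n, k)`, `n ∈ ℕ`, `k ∈ ℤ`,
`a e(n,k) = √(1 - q^(2n)) e(n-1,k)`, `c e(n,k) = q^n e(n,k+1)`, and their adjoints
`d = a*`, `b = -q c*`. -/

/-- The weighted shift `e x ↦ w x • e (s x)`. -/
noncomputable def wshift (s : ℕ × ℤ → ℕ × ℤ) (w : ℕ × ℤ → ℂ) : Module.End ℂ (ℕ × ℤ →₀ ℂ) :=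
  Finsupp.linearCombination ℂ fun x => Finsupp.single (s x) (w x)

theorem wshift_single (s : ℕ × ℤ → ℕ × ℤ) (w : ℕ × ℤ → ℂ) (x : ℕ × ℤ) (z : ℂ) :
    wshift s w (Finsupp.single x z) = Finsupp.single (s x) (z * w x) := by
  simp [wshift]

/-- The coefficient `√(1 - q^(2n))`. -/
noncomputable def rt (q : Param) (n : ℕ) : ℂ := ((√(1 - (q : ℝ) ^ (2 * n)) : ℝ) : ℂ)

theorem rt_arg_nonneg (q : Param) (n : ℕ) : 0 ≤ 1 - (q : ℝ) ^ (2 * n) :=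
  sub_nonneg.2 (pow_le_one₀ q.2.1.le q.2.2.le)

theorem rt_mul_self (q : Param) (n : ℕ) : rt q n * rt q n = 1 - ((q : ℝ) : ℂ) ^ (2 * n) := by
  unfold rt
  rw [← Complex.ofReal_mul, Real.mul_self_sqrt (rt_arg_nonneg q n)]
  push_cast; ring

theorem rt_zero (q : Param) : rt q 0 = 0 := by simp [rt]

theorem norm_rt_le (q : Param) (n : ℕ) : ‖rt q n‖ ≤ 1 := by
  unfold rt
  rw [Complex.norm_real, Real.norm_of_nonneg (Real.sqrt_nonneg _)]
  refine Real.sqrt_le_one.2 ?_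
  have : 0 ≤ (q : ℝ) ^ (2 * n) := pow_nonneg q.2.1.le _
  linarith

theorem conj_rt (q : Param) (n : ℕ) : conj (rt q n) = rt q n := Complex.conj_ofReal _

/-- The representation on generators. -/
noncomputable def repGen (q : Param) : Gen → Module.End ℂ (ℕ × ℤ →₀ ℂ)
  | .a => wshift (fun x => (x.1 - 1, x.2)) (fun x => rt q x.1)
  | .b => wshift (fun x => (x.1, x.2 - 1)) (fun x => -((q : ℝ) : ℂ) ^ (x.1 + 1))
  | .c => wshift (fun x => (x.1, x.2 + 1)) (fun x => ((q : ℝ) : ℂ) ^ x.1)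
  | .d => wshift (fun x => (x.1 + 1, x.2)) (fun x => rt q (x.1 + 1))

theorem repGen_satisfies (q : Param) : Satisfies q (repGen q) := by
  have h0 := Param.ne_zero q
  constructor <;> refine Finsupp.lhom_ext fun ⟨n, k⟩ z => ?_ <;>
    simp only [repGen, Module.End.mul_apply, wshift_single, LinearMap.smul_apply,
      LinearMap.add_apply, Module.End.one_apply, Finsupp.smul_single, smul_eq_mul,
      Nat.add_sub_cancel, sub_add_cancel, add_sub_cancel_right, ← Finsupp.single_add]
  · cases n with
    | zero => simp [rt_zero]
    | succ n => congr 1; simp only [Nat.add_sub_cancel]; ring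
  · cases n with
    | zero => simp [rt_zero]
    | succ n => congr 1; simp only [Nat.add_sub_cancel]; ring
  · congr 1; ring
  · congr 1; ring
  · congr 1; ring
  · congr 1
    rw [mul_assoc, rt_mul_self]; ring
  · cases n with
    | zero =>
      rw [rt_zero, mul_zero, zero_mul, Finsupp.single_zero, eq_comm, Finsupp.single_eq_zero]
      field_simp; ring
    | succ n =>
      simp only [Nat.add_sub_cancel]
      congr 1
      rw [mul_assoc, rt_mul_self]; field_simp; ring

/-- The representation of the coordinate algebra. -/
noncomputable def rep (q : Param) : Coord q →ₐ[ℂ] Module.End ℂ (ℕ × ℤ →₀ ℂ) :=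
  lift q (repGen q) (repGen_satisfies q)

/-- The matrix entries `⟨π(f) e_x, e_y⟩` of the representation. -/
noncomputable def entry (q : Param) (f : Coord q) (y x : ℕ × ℤ) : ℂ :=
  rep q f (Finsupp.single x 1) y

section Entry
variable {q : Param}

theorem entry_add (f g : Coord q) (y x : ℕ × ℤ) :
    entry q (f + g) y x = entry q f y x + entry q g y x := by simp [entry]

theorem entry_smul (z : ℂ) (f : Coord q) (y x : ℕ × ℤ) :
    entry q (z • f) y x = z * entry q f y x := by simp [entry]

theorem entry_algebraMap (z : ℂ) (y x : ℕ × ℤ) :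
    entry q (algebraMap ℂ _ z) y x = if x = y then z else 0 := by
  simp [entry, Module.algebraMap_end_apply, Finsupp.single_apply]

theorem rep_apply_eq_sum (f : Coord q) (v : ℕ × ℤ →₀ ℂ) (y : ℕ × ℤ) {S : Finset (ℕ × ℤ)}
    (hS : v.support ⊆ S) : rep q f v y = ∑ z ∈ S, entry q f y z * v z := by
  have : v = ∑ z ∈ S, v z • Finsupp.single z 1 := by
    conv_lhs => rw [← Finsupp.sum_single v, Finsupp.sum_of_support_subset v hS _ (by simp)]
    simp
  conv_lhs => rw [this]
  rw [map_sum, Finsupp.finsetSum_apply]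
  refine Finset.sum_congr rfl fun z _ => ?_
  rw [map_smul, Finsupp.smul_apply, smul_eq_mul, mul_comm, entry]

theorem entry_mul (f g : Coord q) (y x : ℕ × ℤ) {S : Finset (ℕ × ℤ)}
    (hS : (rep q g (Finsupp.single x 1)).support ⊆ S) :
    entry q (f * g) y x = ∑ z ∈ S, entry q f y z * entry q g z x := by
  conv_lhs => rw [entry, map_mul, Module.End.mul_apply, rep_apply_eq_sum f _ y hS]
  rfl

theorem entry_gen (x : Gen) (y p : ℕ × ℤ) :
    entry q (gen q x) y p = repGen q x (Finsupp.single p 1) y := by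
  simp [entry, rep]

theorem entry_star (f : Coord q) : ∀ y x, entry q (star f) y x = conj (entry q f x y) := by
  induction f using Coord.induction with
  | hC z =>
    intro y x
    rw [star_algebraMap, entry_algebraMap, entry_algebraMap]
    by_cases h : x = y
    · rw [if_pos h, if_pos h.symm]
    · rw [if_neg h, if_neg (Ne.symm h), map_zero]
  | hg g =>
    have key : ∀ (s t : ℕ × ℤ → ℕ × ℤ) (w u : ℕ × ℤ → ℂ),
        (∀ x y, (if s x = y then w x else 0) = conj (if t y = x then u y else 0)) →
        ∀ y x, wshift s w (Finsupp.single x 1) y = conj (wshift t u (Finsupp.single y 1) x) := by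
      intro s t w u h y x
      simp only [wshift_single, one_mul, Finsupp.single_apply]
      exact h x y
    have had : ∀ y x, repGen q .d (Finsupp.single x 1) y
        = conj (repGen q .a (Finsupp.single y 1) x) := by
      refine key _ _ _ _ ?_
      rintro ⟨n, k⟩ ⟨m, l⟩
      rcases m with _ | m
      · simp [rt_zero]
      · by_cases h : n = m ∧ k = l
        · obtain ⟨rfl, rfl⟩ := h; simp [conj_rt]
        · rw [if_neg, if_neg]
          · simp
          · simp only [Nat.add_sub_cancel, Prod.mk.injEq]; tauto
          · simp only [Prod.mk.injEq, add_left_inj]; tauto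
    have hbc : ∀ y x, (-((q : ℝ) : ℂ) • repGen q .c) (Finsupp.single x 1) y
        = conj (repGen q .b (Finsupp.single y 1) x) := by
      intro y x
      have := key (fun x => (x.1, x.2 + 1)) (fun x => (x.1, x.2 - 1))
        (fun x => ((q : ℝ) : ℂ) ^ x.1 * -((q : ℝ) : ℂ)) (fun x => -((q : ℝ) : ℂ) ^ (x.1 + 1)) ?_ y x
      · rw [repGen, repGen, ← this, LinearMap.smul_apply, wshift_single, wshift_single,
          Finsupp.smul_single, smul_eq_mul]
        congr 2; ring
      · rintro ⟨n, k⟩ ⟨m, l⟩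
        by_cases h : n = m ∧ k + 1 = l
        · obtain ⟨rfl, rfl⟩ := h
          simp [Complex.conj_ofReal]; ring
        · rw [if_neg, if_neg]
          · simp
          · simp only [Prod.mk.injEq]; intro h'; apply h; omega
          · simp only [Prod.mk.injEq]; exact h
    intro y x
    have h0 := Param.ne_zero q
    cases g with
    | a => rw [star_gen, genStar, entry_gen, entry_gen]; exact had y x
    | d =>
      rw [star_gen, genStar, entry_gen, entry_gen, had x y, Complex.conj_conj]
    | b => rw [star_gen, genStar, entry_smul, entry_gen, entry_gen]; exact hbc y x
    | c =>
      rw [star_gen, genStar, entry_smul, entry_gen, entry_gen]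
      have := hbc x y
      rw [← Complex.conj_conj (repGen q .b (Finsupp.single x 1) y), ← this]
      simp [Complex.conj_ofReal, h0]
  | hadd f g hf hg => intro y x; rw [star_add, entry_add, entry_add, hf, hg, map_add]
  | hmul f g hf hg =>
    classical
    intro y x
    rw [star_mul, entry_mul _ _ _ _ Finset.subset_union_left,
      entry_mul f g x y (Finset.subset_union_right
        (s₁ := (rep q (star f) (Finsupp.single x 1)).support)), map_sum]
    refine Finset.sum_congr rfl fun z _ => ?_
    rw [hf, hg, map_mul, mul_comm]

open scoped ENNReal in
theorem entry_bounded (f : Coord q) :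
    ∃ C : NNReal, ∀ x, ∑' y, ‖entry q f y x‖ₑ ≤ C := by
  have hsingle : ∀ (x : ℕ × ℤ) (z : ℂ), ∑' y, ‖Finsupp.single x z y‖ₑ = ‖z‖ₑ := by
    intro x z
    rw [tsum_eq_single x]
    · simp
    · intro y hy; simp [hy.symm]
  induction f using Coord.induction with
  | hC z =>
    refine ⟨‖z‖₊, fun x => ?_⟩
    rw [tsum_eq_single x]
    · simp [entry_algebraMap, enorm]
    · intro y hy; simp [entry_algebraMap, hy.symm]
  | hg g =>
    have hq : ∀ n : ℕ, ‖((q : ℝ) : ℂ) ^ n‖ ≤ 1 := fun n => by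
      rw [norm_pow, Complex.norm_real, Real.norm_of_nonneg q.2.1.le]
      exact pow_le_one₀ q.2.1.le q.2.2.le
    refine ⟨1, fun x => ?_⟩
    simp only [entry_gen]
    cases g <;> simp only [repGen, wshift_single, hsingle, one_mul] <;>
      rw [enorm_le_coe, ← NNReal.coe_le_coe, coe_nnnorm, NNReal.coe_one]
    · exact norm_rt_le _ _
    · rw [norm_neg]; exact hq _
    · exact hq _
    · exact norm_rt_le _ _
  | hadd f g hf hg =>
    obtain ⟨C, hC⟩ := hf
    obtain ⟨D, hD⟩ := hg
    refine ⟨C + D, fun x => ?_⟩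
    calc ∑' y, ‖entry q (f + g) y x‖ₑ
        ≤ ∑' y, (‖entry q f y x‖ₑ + ‖entry q g y x‖ₑ) :=
          ENNReal.tsum_le_tsum fun y => by rw [entry_add]; exact enorm_add_le _ _
      _ ≤ (C + D : NNReal) := by
          rw [ENNReal.tsum_add, ENNReal.coe_add]; exact add_le_add (hC x) (hD x)
  | hmul f g hf hg =>
    obtain ⟨C, hC⟩ := hf
    obtain ⟨D, hD⟩ := hg
    refine ⟨C * D, fun x => ?_⟩
    calc ∑' y, ‖entry q (f * g) y x‖ₑ
        ≤ ∑' y, ∑' z, ‖entry q f y z‖ₑ * ‖entry q g z x‖ₑ := by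
          refine ENNReal.tsum_le_tsum fun y => ?_
          rw [entry_mul f g y x subset_rfl]
          refine (enorm_sum_le _ _).trans ?_
          simp only [enorm_mul]
          exact ENNReal.sum_le_tsum _
      _ = ∑' z, (∑' y, ‖entry q f y z‖ₑ) * ‖entry q g z x‖ₑ := by
          rw [ENNReal.tsum_comm]; simp only [ENNReal.tsum_mul_right]
      _ ≤ ∑' z, C * ‖entry q g z x‖ₑ :=
          ENNReal.tsum_le_tsum fun z => mul_le_mul_left (hC z) _
      _ ≤ (C * D : NNReal) := by
          rw [ENNReal.tsum_mul_left, ENNReal.coe_mul]; exact mul_le_mul_right (hD x) _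

theorem haar_summable (f : Coord q) :
    Summable fun n : ℕ => ((q : ℝ) : ℂ) ^ (2 * n) * entry q f (n, 0) (n, 0) := by
  obtain ⟨C, hC⟩ := entry_bounded f
  have hgeo : Summable fun n : ℕ => ((q : ℝ) ^ 2) ^ n * (C : ℝ) :=
    (summable_geometric_of_lt_one (sq_nonneg _)
      (pow_lt_one₀ q.2.1.le q.2.2 two_ne_zero)).mul_right _
  refine Summable.of_norm_bounded hgeo fun n => ?_
  rw [norm_mul, norm_pow, Complex.norm_real, Real.norm_of_nonneg q.2.1.le, pow_mul]
  refine mul_le_mul_of_nonneg_left ?_ (by positivity)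
  have := (ENNReal.le_tsum (n, (0 : ℤ))).trans (hC (n, 0))
  rw [enorm_le_coe] at this
  exact_mod_cast this

end Entry

/-- The Haar functional of `SU_q(2)`,
`h(f) = (1 - q²) ∑ₙ q^(2n) ⟨π(f) e(n,0), e(n,0)⟩`. -/
noncomputable def haar (q : Param) : Coord q →ₗ[ℂ] ℂ where
  toFun f := (1 - ((q : ℝ) : ℂ) ^ 2) * ∑' n : ℕ, ((q : ℝ) : ℂ) ^ (2 * n) * entry q f (n, 0) (n, 0)
  map_add' f g := by
    rw [← mul_add, ← (haar_summable f).tsum_add (haar_summable g)]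
    simp only [entry_add, mul_add]
  map_smul' z f := by
    simp only [entry_smul, RingHom.id_apply, smul_eq_mul, mul_left_comm _ z, tsum_mul_left]

theorem haar_apply (q : Param) (f : Coord q) : haar q f =
    (1 - ((q : ℝ) : ℂ) ^ 2) * ∑' n : ℕ, ((q : ℝ) : ℂ) ^ (2 * n) * entry q f (n, 0) (n, 0) := rfl

theorem haar_one (q : Param) : haar q 1 = 1 := by
  have h1 : ‖((q : ℝ) : ℂ) ^ 2‖ < 1 := by
    rw [norm_pow, Complex.norm_real, Real.norm_of_nonneg q.2.1.le]
    exact pow_lt_one₀ q.2.1.le q.2.2 two_ne_zero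
  have h2 : (1 : ℂ) - ((q : ℝ) : ℂ) ^ 2 ≠ 0 := by
    intro h
    rw [← sub_eq_zero.1 h] at h1
    simp at h1
  rw [haar_apply, ← map_one (algebraMap ℂ (Coord q))]
  simp only [entry_algebraMap, if_true, mul_one, pow_mul]
  rw [tsum_geometric_of_norm_lt_one h1, mul_inv_cancel₀ h2]

theorem haar_star (q : Param) (f : Coord q) : haar q (star f) = conj (haar q f) := by
  rw [haar_apply, haar_apply, map_mul, Complex.conj_tsum]
  simp [entry_star, Complex.conj_ofReal]

theorem haar_mul_star_nonneg (q : Param) (f : Coord q) : 0 ≤ (haar q (f * star f)).re := by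
  have : ∀ n : ℕ, ∃ r : ℝ, 0 ≤ r ∧ ((q : ℝ) : ℂ) ^ (2 * n) * entry q (f * star f) (n, 0) (n, 0)
      = (r : ℂ) := by
    intro n
    refine ⟨(q : ℝ) ^ (2 * n) * ∑ z ∈ (rep q (star f) (Finsupp.single (n, 0) 1)).support,
      ‖entry q f (n, 0) z‖ ^ 2, mul_nonneg (pow_nonneg q.2.1.le _)
        (Finset.sum_nonneg fun _ _ => sq_nonneg _), ?_⟩
    rw [entry_mul f (star f) _ _ subset_rfl]
    push_cast
    congr 1
    refine Finset.sum_congr rfl fun z _ => ?_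
    rw [entry_star, Complex.mul_conj, Complex.normSq_eq_norm_sq]
    push_cast; rfl
  choose r hr hr' using this
  rw [haar_apply]
  simp only [hr']
  rw [← Complex.ofReal_tsum, ← Complex.ofReal_pow, ← Complex.ofReal_one, ← Complex.ofReal_sub,
    ← Complex.ofReal_mul, Complex.ofReal_re]
  exact mul_nonneg (sub_nonneg.2 (pow_le_one₀ q.2.1.le q.2.2.le)) (tsum_nonneg hr)


/-! ### Invariance of the Haar functional -/

section Invariance
variable (q : Param)

/-- Invariance of a functional: `(id ⊗ h)(Δ f) = h(f) 1 = (h ⊗ id)(Δ f)` for all `f`. -/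
def IsHaarFunctional {q : Param} (h : Coord q →ₗ[ℂ] ℂ) : Prop :=
  ∀ f : Coord q,
    TensorProduct.rid ℂ (Coord q) (LinearMap.lTensor (Coord q) h (comul q f)) = h f • 1 ∧
    TensorProduct.lid ℂ (Coord q) (LinearMap.rTensor (Coord q) h (comul q f)) = h f • 1

theorem entry_twist {q : Param} (φ : Coord q →ₐ[ℂ] Coord q) (e : ℕ × ℤ ≃ ℕ × ℤ) (u : ℕ × ℤ → ℂ)
    (hφ : ∀ g y x, entry q (φ (gen q g)) y x * u y = u x * entry q (gen q g) (e y) (e x))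
    (f : Coord q) : ∀ y x, entry q (φ f) y x * u y = u x * entry q f (e y) (e x) := by
  classical
  induction f using Coord.induction with
  | hC z =>
    intro y x
    rw [AlgHom.commutes, entry_algebraMap, entry_algebraMap]
    by_cases h : x = y
    · subst h; simp [mul_comm]
    · simp [h]
  | hg g => exact hφ g
  | hadd f g hf hg => intro y x; rw [map_add, entry_add, entry_add, add_mul, mul_add, hf, hg]
  | hmul f g hf hg =>
    intro y x
    set S := (rep q (φ g) (Finsupp.single x 1)).support ∪
      (rep q g (Finsupp.single (e x) 1)).support.map e.symm.toEmbedding with hS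
    have h2 : (rep q g (Finsupp.single (e x) 1)).support ⊆ S.map e.toEmbedding := by
      intro z hz
      rw [Finset.mem_map_equiv, hS, Finset.mem_union]
      right
      rw [Finset.mem_map_equiv]; simpa using hz
    rw [map_mul, entry_mul _ _ _ _ (S := S) Finset.subset_union_left, entry_mul f g _ _ h2,
      Finset.sum_map, Finset.sum_mul, Finset.mul_sum]
    refine Finset.sum_congr rfl fun z _ => ?_
    have h3 := hf y z
    have h4 := hg z x
    simp only [Equiv.coe_toEmbedding]
    linear_combination (entry q (φ g) z x) * h3 + (entry q f (e y) (e z)) * h4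

theorem haar_twist {q : Param} (φ : Coord q →ₐ[ℂ] Coord q) (e : ℕ × ℤ ≃ ℕ × ℤ) (u : ℕ × ℤ → ℂ)
    (hφ : ∀ g y x, entry q (φ (gen q g)) y x * u y = u x * entry q (gen q g) (e y) (e x))
    (he : ∀ n, e (n, 0) = (n, 0)) (hu : ∀ x, u x ≠ 0) (f : Coord q) :
    haar q (φ f) = haar q f := by
  rw [haar_apply, haar_apply]
  congr 2; ext n
  have := entry_twist φ e u hφ f (n, 0) (n, 0)
  rw [he, mul_comm] at this
  rw [mul_left_cancel₀ (hu _) this]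

/-- The torus automorphism used in the proof of invariance. -/
noncomputable def kAut : Coord q →ₐ[ℂ] Coord q :=
  lift q (fun
    | .a => ((q : ℝ) : ℂ) • gen q .a
    | .b => ((q : ℝ) : ℂ)⁻¹ • gen q .b
    | .c => ((q : ℝ) : ℂ) • gen q .c
    | .d => ((q : ℝ) : ℂ)⁻¹ • gen q .d) <| by
    have h0 := Param.ne_zero q
    constructor <;> simp only [smul_mul_assoc, mul_smul_comm, gen_ab, gen_ac, gen_bd,
      gen_cd, gen_ad, gen_da, gen_bc] <;> match_scalars <;> field_simp

theorem haar_kAut (f : Coord q) : haar q (kAut q f) = haar q f := by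
  have h0 := Param.ne_zero q
  refine haar_twist (kAut q) (Equiv.refl _) (fun x => ((q : ℝ) : ℂ) ^ ((x.1 : ℤ) - x.2)) ?_
    (fun _ => rfl) (fun _ => zpow_ne_zero _ h0) f
  rintro g ⟨n, k⟩ ⟨m, l⟩
  cases g <;> simp only [kAut, lift_gen, entry_smul, entry_gen, repGen, wshift_single, one_mul,
    Finsupp.single_apply, Equiv.refl_apply, Prod.mk.injEq]
  · rcases m with _ | m
    · simp [rt_zero]
    · simp only [Nat.add_sub_cancel]
      by_cases h : m = n ∧ l = k
      · obtain ⟨rfl, rfl⟩ := h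
        simp only [true_and, if_true]
        push_cast
        rw [show (m : ℤ) + 1 - l = (m - l) + 1 by ring, zpow_add_one₀ h0]; ring
      · simp [h]
  · by_cases h : m = n ∧ l - 1 = k
    · obtain ⟨rfl, rfl⟩ := h
      simp only [true_and, if_true]
      rw [show (m : ℤ) - (l - 1) = (m - l) + 1 by ring, zpow_add_one₀ h0]; field_simp
    · simp [h]
  · by_cases h : m = n ∧ l + 1 = k
    · obtain ⟨rfl, rfl⟩ := h
      simp only [true_and, if_true]
      rw [show (m : ℤ) - l = (m - (l + 1)) + 1 by ring, zpow_add_one₀ h0]; ring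
    · simp [h]
  · by_cases h : m + 1 = n ∧ l = k
    · obtain ⟨rfl, rfl⟩ := h
      simp only [true_and, if_true]
      push_cast
      rw [show (m : ℤ) + 1 - l = (m - l) + 1 by ring, zpow_add_one₀ h0]; field_simp
    · simp [h]

/-- The automorphism exchanging `b` and `c`. -/
noncomputable def flipAut : Coord q →ₐ[ℂ] Coord q :=
  lift q (fun
    | .a => gen q .a
    | .b => gen q .c
    | .c => gen q .b
    | .d => gen q .d) <| by
    constructor <;> simp only [gen_ab, gen_ac, gen_bd, gen_cd, gen_ad, gen_da, gen_bc]

theorem haar_flipAut (f : Coord q) : haar q (flipAut q f) = haar q f := by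
  have h0 := Param.ne_zero q
  have h1 : -((q : ℝ) : ℂ) ≠ 0 := neg_ne_zero.2 h0
  refine haar_twist (flipAut q) ((Equiv.refl ℕ).prodCongr (Equiv.neg ℤ))
    (fun x => (-((q : ℝ) : ℂ)) ^ x.2) ?_ (fun _ => rfl) (fun _ => zpow_ne_zero _ h1) f
  rintro g ⟨n, k⟩ ⟨m, l⟩
  cases g <;> simp only [flipAut, lift_gen, entry_gen, repGen, wshift_single, one_mul,
    Finsupp.single_apply, Equiv.prodCongr_apply, Prod.map, Equiv.refl_apply, Equiv.neg_apply,
    Prod.mk.injEq, neg_inj]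
  · by_cases h : m - 1 = n ∧ l = k
    · obtain ⟨rfl, rfl⟩ := h; simp [mul_comm]
    · simp [h]
  · by_cases h : m = n ∧ l + 1 = k
    · obtain ⟨rfl, rfl⟩ := h
      rw [if_pos ⟨rfl, rfl⟩, if_pos ⟨rfl, by ring⟩, zpow_add_one₀ h1]; ring
    · rw [if_neg h, if_neg (fun h' => h ⟨h'.1, by have := h'.2; omega⟩)]; simp
  · by_cases h : m = n ∧ l - 1 = k
    · obtain ⟨rfl, rfl⟩ := h
      rw [if_pos ⟨rfl, rfl⟩, if_pos ⟨rfl, by ring⟩, zpow_sub_one₀ h1]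
      field_simp; ring
    · rw [if_neg h, if_neg (fun h' => h ⟨h'.1, by have := h'.2; omega⟩)]; simp
  · by_cases h : m + 1 = n ∧ l = k
    · obtain ⟨rfl, rfl⟩ := h; simp [mul_comm]
    · simp [h]

/-- `f ↦ (k(f), E(f); 0, f)`, for a twisted derivation `E` with `E a = b`, `E c = d`. -/
noncomputable def derivHom : Coord q →ₐ[ℂ] Matrix (Fin 2) (Fin 2) (Coord q) :=
  lift q (fun
    | .a => !![((q : ℝ) : ℂ) • gen q .a, gen q .b; 0, gen q .a]
    | .b => !![((q : ℝ) : ℂ)⁻¹ • gen q .b, 0; 0, gen q .b]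
    | .c => !![((q : ℝ) : ℂ) • gen q .c, gen q .d; 0, gen q .c]
    | .d => !![((q : ℝ) : ℂ)⁻¹ • gen q .d, 0; 0, gen q .d]) <| by
    have h0 := Param.ne_zero q
    constructor <;> ext i j <;> fin_cases i <;> fin_cases j <;>
    simp [Matrix.mul_apply, Fin.sum_univ_two, gen_ab, gen_ac, gen_bd, gen_cd, gen_ad, gen_da,
      gen_bc, smul_smul, h0, -Complex.coe_smul] <;> try match_scalars <;> field_simp


theorem derivHom_entries (f : Coord q) :
    derivHom q f 0 0 = kAut q f ∧ derivHom q f 1 0 = 0 ∧ derivHom q f 1 1 = f := by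
  induction f using Coord.induction with
  | hC z => simp [Matrix.algebraMap_matrix_apply]
  | hg g => cases g <;> simp [derivHom, kAut]
  | hadd f g hf hg => simp [hf, hg]
  | hmul f g hf hg => simp [Matrix.mul_apply, Fin.sum_univ_two, hf, hg]

/-- The twisted derivation `E`. -/
noncomputable def deriv : Coord q →ₗ[ℂ] Coord q where
  toFun f := derivHom q f 0 1
  map_add' f g := by simp
  map_smul' z f := by simp

theorem deriv_mul (f g : Coord q) :
    deriv q (f * g) = kAut q f * deriv q g + deriv q f * g := by
  have hf := derivHom_entries q f
  have hg := derivHom_entries q g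
  simp [deriv, Matrix.mul_apply, Fin.sum_univ_two, hf, hg]

theorem deriv_one : deriv q 1 = 0 := by simp [deriv]

theorem deriv_gen : deriv q (gen q .a) = gen q .b ∧ deriv q (gen q .b) = 0 ∧
    deriv q (gen q .c) = gen q .d ∧ deriv q (gen q .d) = 0 := by
  simp [deriv, derivHom]

theorem comul_kAut (f : Coord q) : comul q (kAut q f) =
    Algebra.TensorProduct.map (AlgHom.id ℂ (Coord q)) (kAut q) (comul q f) := by
  induction f using Coord.induction with
  | hC z => simp only [AlgHom.commutes]
  | hg g => cases g <;> simp [comul, kAut, smul_add, -Complex.coe_smul]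
  | hadd f g hf hg => simp only [map_add, hf, hg]
  | hmul f g hf hg => simp only [map_mul, hf, hg]

theorem lTensor_deriv_mul (x y : Coord q ⊗[ℂ] Coord q) :
    (deriv q).lTensor (Coord q) (x * y) =
      Algebra.TensorProduct.map (AlgHom.id ℂ (Coord q)) (kAut q) x *
        (deriv q).lTensor (Coord q) y + (deriv q).lTensor (Coord q) x * y := by
  induction x with
  | zero => simp
  | add x x' hx hx' => simp only [add_mul, map_add, hx, hx']; abel
  | tmul x x' =>
    induction y with
    | zero => simp
    | add y y' hy hy' => simp only [mul_add, map_add, hy, hy']; abel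
    | tmul y y' => simp [deriv_mul, TensorProduct.tmul_add]

theorem comul_deriv (f : Coord q) :
    comul q (deriv q f) = (deriv q).lTensor (Coord q) (comul q f) := by
  induction f using Coord.induction with
  | hC z => rw [Algebra.algebraMap_eq_smul_one]; simp [deriv_one, Algebra.TensorProduct.one_def]
  | hg g =>
    have h := deriv_gen q
    cases g <;> simp [h] <;> simp [comul, h]
  | hadd f g hf hg => simp only [map_add, hf, hg]
  | hmul f g hf hg =>
    rw [deriv_mul, map_add, map_mul, map_mul, map_mul, lTensor_deriv_mul, hf, hg, comul_kAut]

/-- The monomials `a^i c^j b^k d^m`. -/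
noncomputable def mon (i j k m : ℕ) : Coord q :=
  gen q .a ^ i * gen q .c ^ j * gen q .b ^ k * gen q .d ^ m

theorem pow_qcomm {q : Param} {x y : Coord q} {r : ℂ} (h : y * x = r • (x * y)) (n : ℕ) :
    y ^ n * x = r ^ n • (x * y ^ n) := by
  induction n with
  | zero => simp
  | succ n ih =>
    rw [pow_succ, mul_assoc, h, mul_smul_comm, ← mul_assoc, ih, smul_mul_assoc, smul_smul,
      mul_assoc, ← pow_succ, ← pow_succ', pow_succ]

theorem gen_inv_comm {q : Param} {x y : Coord q} (h : x * y = ((q : ℝ) : ℂ) • (y * x)) :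
    y * x = ((q : ℝ) : ℂ)⁻¹ • (x * y) := by
  rw [h, smul_smul, inv_mul_cancel₀ (Param.ne_zero q), one_smul]

theorem pow_gen_ba (n : ℕ) : gen q .b ^ n * gen q .a =
    (((q : ℝ) : ℂ)⁻¹) ^ n • (gen q .a * gen q .b ^ n) := pow_qcomm (gen_inv_comm (gen_ab q)) n
theorem pow_gen_ca (n : ℕ) : gen q .c ^ n * gen q .a =
    (((q : ℝ) : ℂ)⁻¹) ^ n • (gen q .a * gen q .c ^ n) := pow_qcomm (gen_inv_comm (gen_ac q)) n
theorem pow_gen_db (n : ℕ) : gen q .d ^ n * gen q .b =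
    (((q : ℝ) : ℂ)⁻¹) ^ n • (gen q .b * gen q .d ^ n) := pow_qcomm (gen_inv_comm (gen_bd q)) n
theorem pow_gen_dc (n : ℕ) : gen q .d ^ n * gen q .c =
    (((q : ℝ) : ℂ)⁻¹) ^ n • (gen q .c * gen q .d ^ n) := pow_qcomm (gen_inv_comm (gen_cd q)) n

theorem pow_gen_bd (n : ℕ) : gen q .d * gen q .b ^ n =
    (((q : ℝ) : ℂ)⁻¹) ^ n • (gen q .b ^ n * gen q .d) := by
  induction n with
  | zero => simp
  | succ n ih =>
    rw [pow_succ, ← mul_assoc, ih, smul_mul_assoc, mul_assoc, gen_inv_comm (gen_bd q),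
      mul_smul_comm, smul_smul, ← mul_assoc, pow_succ]

theorem pow_gen_bc (n : ℕ) : gen q .b * gen q .c ^ n = gen q .c ^ n * gen q .b :=
  ((show Commute _ _ from gen_bc q).pow_right n)
theorem pow_gen_bc' (n : ℕ) : gen q .b ^ n * gen q .c = gen q .c * gen q .b ^ n :=
  ((show Commute _ _ from gen_bc q).pow_left n)

theorem span_mon : Submodule.span ℂ {x | ∃ i j k m, x = mon q i j k m} = ⊤ := by
  set S := Submodule.span ℂ {x | ∃ i j k m, x = mon q i j k m} with hS
  have hm : ∀ i j k m, mon q i j k m ∈ S := fun i j k m =>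
    Submodule.subset_span ⟨i, j, k, m, rfl⟩
  have ext : ∀ g : Coord q, (∀ i j k m, mon q i j k m * g ∈ S) → ∀ s ∈ S, s * g ∈ S := by
    intro g h s hs
    induction hs using Submodule.span_induction with
    | mem x hx => obtain ⟨i, j, k, m, rfl⟩ := hx; exact h i j k m
    | zero => simp
    | add x y _ _ hx hy => rw [add_mul]; exact S.add_mem hx hy
    | smul z x _ hx => rw [smul_mul_assoc]; exact S.smul_mem _ hx
  have hd : ∀ s ∈ S, s * gen q .d ∈ S := ext _ fun i j k m => by
    rw [mon, mul_assoc, ← pow_succ]; exact hm _ _ _ _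
  have hb : ∀ s ∈ S, s * gen q .b ∈ S := ext _ fun i j k m => by
    rw [mon, mul_assoc, pow_gen_db, mul_smul_comm, ← mul_assoc, mul_assoc _ (gen q .b ^ k),
      ← pow_succ]
    exact S.smul_mem _ (hm _ _ _ _)
  have hc : ∀ s ∈ S, s * gen q .c ∈ S := ext _ fun i j k m => by
    rw [mon, mul_assoc, pow_gen_dc, mul_smul_comm, ← mul_assoc, mul_assoc _ (gen q .b ^ k),
      pow_gen_bc', ← mul_assoc, mul_assoc _ (gen q .c ^ j), ← pow_succ]
    exact S.smul_mem _ (hm _ _ _ _)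
  have ha : ∀ s ∈ S, s * gen q .a ∈ S := ext _ fun i j k m => by
    rcases m with _ | m
    · rw [mon, pow_zero, mul_one, mul_assoc, pow_gen_ba, mul_smul_comm, ← mul_assoc,
        mul_assoc _ (gen q .c ^ j), pow_gen_ca, mul_smul_comm, ← mul_assoc, ← pow_succ,
        smul_mul_assoc]
      have := hm (i + 1) j k 0
      rw [mon, pow_zero, mul_one] at this
      exact S.smul_mem _ (S.smul_mem _ this)
    · have : mon q i j k (m + 1) * gen q .a = mon q i j k m +
          ((q : ℝ) : ℂ)⁻¹ • (mon q i j k m * gen q .b * gen q .c) := by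
        rw [mon, pow_succ, ← mul_assoc, mul_assoc _ (gen q .d), gen_da, mul_add, mul_one,
          mul_smul_comm, mul_assoc _ (gen q .b) (gen q .c)]
        rfl
      rw [this]
      exact S.add_mem (hm _ _ _ _) (S.smul_mem _ (hc _ (hb _ (hm _ _ _ _))))
  rw [eq_top_iff]
  rintro f -
  have key : ∀ s ∈ S, s * f ∈ S := by
    induction f using Coord.induction with
    | hC z =>
      intro s hs
      rw [← Algebra.commutes, ← Algebra.smul_def]; exact S.smul_mem _ hs
    | hg g => cases g; exacts [ha, hb, hc, hd]
    | hadd f g hf hg => intro s hs; rw [mul_add]; exact S.add_mem (hf s hs) (hg s hs)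
    | hmul f g hf hg => intro s hs; rw [← mul_assoc]; exact hg _ (hf _ hs)
  have := key 1 (by simpa [mon] using hm 0 0 0 0)
  rwa [one_mul] at this

/-- The numbers `(q^i - q^(-i)) / (q - q⁻¹)`. -/
noncomputable def num : ℕ → ℝ
  | 0 => 0
  | n + 1 => (q : ℝ) * num n + ((q : ℝ)⁻¹) ^ n

theorem num_nonneg (n : ℕ) : 0 ≤ num q n := by
  have := q.2.1
  induction n with
  | zero => simp [num]
  | succ n ih => rw [num]; positivity

theorem num_succ_pos (n : ℕ) : 0 < num q (n + 1) := by
  have := q.2.1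
  have := num_nonneg q n
  rw [num]; positivity

theorem num_eq (n : ℕ) : ((q : ℝ) ^ 2 - 1) * (q : ℝ) ^ n * num q (n + 1) =
    (q : ℝ) ^ (2 * n + 2) - 1 := by
  have h0 : (q : ℝ) ≠ 0 := q.2.1.ne'
  induction n with
  | zero => simp [num]
  | succ n ih =>
    rw [num, inv_pow]
    have : ((q : ℝ) ^ 2 - 1) * (q : ℝ) ^ (n + 1) * ((q : ℝ) * num q (n + 1) + ((q : ℝ) ^ (n + 1))⁻¹)
      = (q : ℝ) ^ 2 * (((q : ℝ) ^ 2 - 1) * (q : ℝ) ^ n * num q (n + 1)) + ((q : ℝ) ^ 2 - 1) := by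
      field_simp; ring
    rw [this, ih]; ring

theorem kAut_gen : kAut q (gen q .a) = ((q : ℝ) : ℂ) • gen q .a ∧
    kAut q (gen q .b) = ((q : ℝ) : ℂ)⁻¹ • gen q .b ∧
    kAut q (gen q .c) = ((q : ℝ) : ℂ) • gen q .c ∧
    kAut q (gen q .d) = ((q : ℝ) : ℂ)⁻¹ • gen q .d := by
  simp [kAut, -Complex.coe_smul]

theorem deriv_pow_zero {q : Param} {x : Coord q} (h : deriv q x = 0) (n : ℕ) :
    deriv q (x ^ n) = 0 := by
  induction n with
  | zero => simp [deriv_one]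
  | succ n ih => rw [pow_succ, deriv_mul, h, ih]; simp

theorem deriv_pow {q : Param} {x y : Coord q} (hk : kAut q x = ((q : ℝ) : ℂ) • x)
    (h : deriv q x = y) (hxy : x * y = ((q : ℝ) : ℂ) • (y * x)) (n : ℕ) :
    deriv q (x ^ (n + 1)) = (num q (n + 1) : ℂ) • (x ^ n * y) := by
  have hyx := gen_inv_comm hxy
  have hyn : ∀ n : ℕ, y * x ^ n = (((q : ℝ) : ℂ)⁻¹) ^ n • (x ^ n * y) := by
    intro n
    induction n with
    | zero => simp
    | succ n ih =>
      rw [pow_succ, ← mul_assoc, ih, smul_mul_assoc, mul_assoc, hyx, mul_smul_comm, smul_smul,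
        ← mul_assoc, pow_succ]
  induction n with
  | zero => simp [h, num]
  | succ n ih =>
    rw [pow_succ' x (n + 1), deriv_mul, h, hk, ih, hyn,
      show num q (n + 1 + 1) = (q : ℝ) * num q (n + 1) + ((q : ℝ)⁻¹) ^ (n + 1) from rfl]
    rw [smul_mul_smul_comm, ← mul_assoc, ← pow_succ']
    push_cast
    module

theorem deriv_mon (i j k m : ℕ) : deriv q (mon q i j k m) =
    (num q i : ℂ) • mon q (i - 1) j (k + 1) m +
      (((q : ℝ) : ℂ) ^ i * (((q : ℝ) : ℂ)⁻¹) ^ k * num q j) • mon q i (j - 1) k (m + 1) := by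
  obtain ⟨ea, eb, ec, ed⟩ := deriv_gen q
  obtain ⟨ka, -, kc, -⟩ := kAut_gen q
  have h1 : deriv q (mon q i j k m) = (kAut q (gen q .a ^ i) * deriv q (gen q .c ^ j) +
      deriv q (gen q .a ^ i) * gen q .c ^ j) * gen q .b ^ k * gen q .d ^ m := by
    rw [mon, deriv_mul, deriv_pow_zero ed, deriv_mul, deriv_pow_zero eb, deriv_mul]
    simp
  have h2 : kAut q (gen q .a ^ i) = ((q : ℝ) : ℂ) ^ i • gen q .a ^ i := by
    rw [map_pow, ka, smul_pow]
  have h3 : deriv q (gen q .a ^ i) * gen q .c ^ j * gen q .b ^ k * gen q .d ^ m =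
      (num q i : ℂ) • mon q (i - 1) j (k + 1) m := by
    rcases i with _ | i
    · simp [deriv_one, num]
    · rw [deriv_pow ka ea (gen_ab q), smul_mul_assoc, smul_mul_assoc, smul_mul_assoc,
        mul_assoc _ (gen q .b), pow_gen_bc, ← mul_assoc, mul_assoc _ (gen q .b), ← pow_succ',
        Nat.add_sub_cancel, mon]
  have h4 : gen q .a ^ i * deriv q (gen q .c ^ j) * gen q .b ^ k * gen q .d ^ m =
      ((((q : ℝ) : ℂ)⁻¹) ^ k * num q j) • mon q i (j - 1) k (m + 1) := by
    rcases j with _ | j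
    · simp [deriv_one, num]
    · rw [deriv_pow kc ec (gen_cd q), mul_smul_comm, smul_mul_assoc, smul_mul_assoc,
        ← mul_assoc, mul_assoc _ (gen q .d), pow_gen_bd, mul_smul_comm, smul_mul_assoc, smul_smul,
        ← mul_assoc, mul_assoc _ (gen q .d), ← pow_succ', Nat.add_sub_cancel, mon, mul_comm]
  rw [h1, add_mul, add_mul, h3, h2, smul_mul_assoc, smul_mul_assoc, smul_mul_assoc, h4, smul_smul,
    add_comm, mul_assoc]


theorem rep_pow_d (m n : ℕ) (l : ℤ) (z : ℂ) :
    rep q (gen q .d ^ m) (Finsupp.single (n, l) z) =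
      Finsupp.single (n + m, l) (z * ∏ r ∈ Finset.range m, rt q (n + r + 1)) := by
  induction m with
  | zero => simp
  | succ m ih =>
    rw [pow_succ', map_mul, Module.End.mul_apply, ih, rep, lift_gen, repGen, wshift_single,
      Finset.prod_range_succ, mul_assoc]
    rfl

theorem rep_pow_a (m n : ℕ) (l : ℤ) (z : ℂ) :
    rep q (gen q .a ^ m) (Finsupp.single (n + m, l) z) =
      Finsupp.single (n, l) (z * ∏ r ∈ Finset.range m, rt q (n + r + 1)) := by
  induction m generalizing z with
  | zero => simp
  | succ m ih =>
    rw [pow_succ, map_mul, Module.End.mul_apply, rep, lift_gen, repGen, wshift_single, ← rep,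
      show (n + (m + 1) - 1) = n + m by omega, ih, Finset.prod_range_succ,
      show n + (m + 1) = n + m + 1 by omega]
    congr 1; ring

theorem rep_pow_b (k n : ℕ) (l : ℤ) (z : ℂ) :
    rep q (gen q .b ^ k) (Finsupp.single (n, l) z) =
      Finsupp.single (n, l - k) (z * (-((q : ℝ) : ℂ) ^ (n + 1)) ^ k) := by
  induction k with
  | zero => simp
  | succ k ih =>
    rw [pow_succ', map_mul, Module.End.mul_apply, ih, rep, lift_gen, repGen, wshift_single,
      pow_succ, mul_assoc]
    congr 2; push_cast; ring

theorem rep_pow_c (k n : ℕ) (l : ℤ) (z : ℂ) :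
    rep q (gen q .c ^ k) (Finsupp.single (n, l) z) =
      Finsupp.single (n, l + k) (z * (((q : ℝ) : ℂ) ^ n) ^ k) := by
  induction k with
  | zero => simp
  | succ k ih =>
    rw [pow_succ', map_mul, Module.End.mul_apply, ih, rep, lift_gen, repGen, wshift_single,
      pow_succ, mul_assoc]
    congr 2; push_cast; ring

/-- The product `∏_{r < m} (1 - q^(2(n+r+1)))`. -/
noncomputable def qprod (m n : ℕ) : ℂ :=
  ∏ r ∈ Finset.range m, (1 - ((q : ℝ) : ℂ) ^ (2 * (n + r + 1)))

theorem entry_mon (j m n : ℕ) : entry q (mon q m j j m) (n, 0) (n, 0) =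
    qprod q m n * (-1) ^ j * ((q : ℝ) : ℂ) ^ ((2 * n + 2 * m + 1) * j) := by
  have h : (∏ r ∈ Finset.range m, rt q (n + r + 1)) * (∏ r ∈ Finset.range m, rt q (n + r + 1)) =
      qprod q m n := by
    rw [← Finset.prod_mul_distrib]; exact Finset.prod_congr rfl fun r _ => rt_mul_self q _
  rw [entry, mon, map_mul, map_mul, map_mul, Module.End.mul_apply, Module.End.mul_apply,
    Module.End.mul_apply, rep_pow_d, rep_pow_b, rep_pow_c, rep_pow_a, sub_add_cancel,
    Finsupp.single_eq_same, ← h, neg_pow]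
  ring

theorem kAut_mon (i j k m : ℕ) : kAut q (mon q i j k m) =
    ((q : ℝ) : ℂ) ^ ((i : ℤ) + j - k - m) • mon q i j k m := by
  obtain ⟨ka, kb, kc, kd⟩ := kAut_gen q
  have h0 := Param.ne_zero q
  rw [mon, map_mul, map_mul, map_mul, map_pow, map_pow, map_pow, map_pow, ka, kb, kc, kd,
    smul_pow, smul_pow, smul_pow, smul_pow, smul_mul_smul_comm, smul_mul_smul_comm,
    smul_mul_smul_comm, zpow_sub₀ h0, zpow_sub₀ h0, zpow_add₀ h0]
  congr 1
  simp only [zpow_natCast, inv_pow, div_eq_mul_inv]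

theorem zpow_ne_one {w : ℤ} (hw : w ≠ 0) : ((q : ℝ) : ℂ) ^ w ≠ 1 := by
  intro h
  have h1 : ((q : ℝ)) ^ w = 1 := by exact_mod_cast h
  rw [zpow_eq_one_iff_right₀ q.2.1.le q.2.2.ne] at h1
  exact hw h1

theorem haar_mon_weight {i j k m : ℕ} (h : i + j ≠ k + m) : haar q (mon q i j k m) = 0 := by
  have h1 := haar_kAut q (mon q i j k m)
  rw [kAut_mon, map_smul, smul_eq_mul] at h1
  have h2 := zpow_ne_one q (w := (i : ℤ) + j - k - m) (by omega)
  have h3 := sub_ne_zero.2 h2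
  refine (mul_eq_zero.1 (?_ : (((q : ℝ) : ℂ) ^ ((i : ℤ) + j - k - m) - 1) * _ = 0)).resolve_left h3
  rw [sub_mul, h1, one_mul, sub_self]

theorem flipAut_mon (i j k m : ℕ) : flipAut q (mon q i j k m) = mon q i k j m := by
  simp only [mon, map_mul, map_pow, flipAut, lift_gen]
  rw [mul_assoc (gen q .a ^ i), mul_assoc (gen q .a ^ i),
    (show Commute _ _ from gen_bc q).pow_pow j k, ← mul_assoc, ← mul_assoc]

theorem haar_mon_eq_zero {i j k m : ℕ} (h : ¬ (i = m ∧ j = k)) : haar q (mon q i j k m) = 0 := by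
  by_cases h1 : i + j = k + m
  · rw [← haar_flipAut, flipAut_mon]
    exact haar_mon_weight q (by omega)
  · exact haar_mon_weight q h1

theorem norm_q : ‖((q : ℝ) : ℂ)‖ = q := by
  rw [Complex.norm_real, Real.norm_of_nonneg q.2.1.le]

theorem norm_qprod_le (m n : ℕ) : ‖qprod q m n‖ ≤ 1 := by
  rw [qprod, norm_prod]
  refine Finset.prod_le_one (fun _ _ => norm_nonneg _) fun r _ => ?_
  rw [← rt_mul_self, norm_mul]
  exact mul_le_one₀ (norm_rt_le q _) (norm_nonneg _) (norm_rt_le q _)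

theorem qprod_shift (m n : ℕ) : (1 - ((q : ℝ) : ℂ) ^ (2 * (n + 1))) * qprod q m (n + 1) =
    qprod q m n * (1 - ((q : ℝ) : ℂ) ^ (2 * (n + m + 1))) := by
  have h1 : qprod q (m + 1) n = qprod q m n * (1 - ((q : ℝ) : ℂ) ^ (2 * (n + m + 1))) := by
    rw [qprod, Finset.prod_range_succ]; rfl
  rw [← h1, qprod, qprod, Finset.prod_range_succ', mul_comm]
  congr 1
  exact Finset.prod_congr rfl fun r _ => by congr 2; ring

theorem haar_deriv_aux (k m : ℕ) :
    (num q (m + 1) : ℂ) * haar q (mon q m (k + 1) (k + 1) m) +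
      (((q : ℝ) : ℂ) ^ (m + 1) * (((q : ℝ) : ℂ)⁻¹) ^ k * num q (k + 1)) *
        haar q (mon q (m + 1) k k (m + 1)) = 0 := by
  have h0 := Param.ne_zero q
  set Q : ℂ := ((q : ℝ) : ℂ) with hQ
  have hN : ∀ n, (Q ^ 2 - 1) * Q ^ n * (num q (n + 1) : ℂ) = Q ^ (2 * n + 2) - 1 := fun n => by
    rw [hQ]; exact_mod_cast num_eq q n
  set G : ℕ → ℂ := fun n => Q ^ (2 * n * (k + 1)) * ((1 - Q ^ (2 * n)) * qprod q m n) with hG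
  have hGs : Summable G := by
    refine Summable.of_norm_bounded (g := fun n => ((q : ℝ) ^ 2) ^ n)
      (summable_geometric_of_lt_one (sq_nonneg _) (pow_lt_one₀ q.2.1.le q.2.2 two_ne_zero))
      fun n => ?_
    have h1 : ‖1 - Q ^ (2 * n)‖ ≤ 1 := by
      rw [hQ, ← rt_mul_self, norm_mul]
      exact mul_le_one₀ (norm_rt_le q _) (norm_nonneg _) (norm_rt_le q _)
    have h2 : ‖Q ^ (2 * n * (k + 1))‖ ≤ ((q : ℝ) ^ 2) ^ n := by
      rw [norm_pow, hQ, norm_q, ← pow_mul]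
      exact pow_le_pow_of_le_one q.2.1.le q.2.2.le (Nat.le_mul_of_pos_right _ (Nat.succ_pos k))
    calc ‖G n‖ = ‖Q ^ (2 * n * (k + 1))‖ * (‖1 - Q ^ (2 * n)‖ * ‖qprod q m n‖) := by
          rw [hG]; simp only [norm_mul]
      _ ≤ ((q : ℝ) ^ 2) ^ n * 1 := mul_le_mul h2
          (mul_le_one₀ h1 (norm_nonneg _) (norm_qprod_le q m n)) (by positivity) (by positivity)
      _ = _ := mul_one _
  have hG0 : G 0 = 0 := by simp [hG]
  have htel : ∑' n, (G n - G (n + 1)) = 0 := by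
    rw [hGs.tsum_sub ((summable_nat_add_iff 1).2 hGs), hGs.tsum_eq_zero_add, hG0]; ring
  have hA := haar_summable (mon q m (k + 1) (k + 1) m)
  have hB := haar_summable (mon q (m + 1) k k (m + 1))
  have hK : (Q ^ 2 - 1) * Q ^ m * Q ^ k ≠ 0 := by
    refine mul_ne_zero (mul_ne_zero (sub_ne_zero.2 ?_) (pow_ne_zero _ h0)) (pow_ne_zero _ h0)
    have := zpow_ne_one q (w := 2) two_ne_zero
    rwa [zpow_ofNat] at this
  refine (mul_eq_zero.1 (?_ : ((Q ^ 2 - 1) * Q ^ m * Q ^ k) * _ = 0)).resolve_left hK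
  rw [haar_apply, haar_apply, ← hQ]
  have hcomb : ∑' n, ((Q ^ 2 - 1) * Q ^ m * Q ^ k * (num q (m + 1) : ℂ) *
        (Q ^ (2 * n) * entry q (mon q m (k + 1) (k + 1) m) (n, 0) (n, 0)) +
      (Q ^ 2 - 1) * Q ^ m * Q ^ k * (Q ^ (m + 1) * Q⁻¹ ^ k * num q (k + 1)) *
        (Q ^ (2 * n) * entry q (mon q (m + 1) k k (m + 1)) (n, 0) (n, 0))) = 0 := by
    have : ∀ n, ((Q ^ 2 - 1) * Q ^ m * Q ^ k * (num q (m + 1) : ℂ) *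
        (Q ^ (2 * n) * entry q (mon q m (k + 1) (k + 1) m) (n, 0) (n, 0)) +
      (Q ^ 2 - 1) * Q ^ m * Q ^ k * (Q ^ (m + 1) * Q⁻¹ ^ k * num q (k + 1)) *
        (Q ^ (2 * n) * entry q (mon q (m + 1) k k (m + 1)) (n, 0) (n, 0))) =
      ((-1) ^ (k + 1) * Q ^ (2 * m * k + 2 * m + 2 * k + 1)) * (G n - G (n + 1)) := by
      intro n
      have hs := qprod_shift q m n
      have e1 : (Q ^ 2 - 1) * Q ^ m * Q ^ k * (num q (m + 1) : ℂ) =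
          (Q ^ (2 * m + 2) - 1) * Q ^ k := by rw [← hN m]; ring
      have e2 : (Q ^ 2 - 1) * Q ^ m * Q ^ k * (Q ^ (m + 1) * Q⁻¹ ^ k * num q (k + 1)) =
          (Q ^ (2 * k + 2) - 1) * Q ^ (2 * m + 1) * Q⁻¹ ^ k := by rw [← hN k]; ring
      have e3 : Q⁻¹ ^ k * Q ^ ((2 * n + 2 * (m + 1) + 1) * k) = Q ^ ((2 * n + 2 * m + 2) * k) := by
        rw [inv_pow, show (2 * n + 2 * (m + 1) + 1) * k = (2 * n + 2 * m + 2) * k + k by ring,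
          pow_add, mul_comm (Q ^ _) (Q ^ k), inv_mul_cancel_left₀ (pow_ne_zero _ h0)]
      have e4 : qprod q (m + 1) n = qprod q m n * (1 - Q ^ (2 * (n + m + 1))) := by
        rw [qprod, Finset.prod_range_succ]; rfl
      rw [e1, e2, entry_mon, entry_mon, e4, ← hQ, hG]
      simp only
      rw [hs, ← hQ]
      linear_combination ((Q ^ (2 * k + 2) - 1) * Q ^ (2 * m + 1) * Q ^ (2 * n) * qprod q m n *
        (1 - Q ^ (2 * (n + m + 1))) * (-1) ^ k) * e3
    simp only [this]
    rw [tsum_mul_left, htel, mul_zero]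
  rw [(hA.mul_left _).tsum_add (hB.mul_left _), tsum_mul_left, tsum_mul_left] at hcomb
  linear_combination (1 - Q ^ 2) * hcomb

theorem haar_deriv (f : Coord q) : haar q (deriv q f) = 0 := by
  have hf : f ∈ Submodule.span ℂ {x | ∃ i j k m, x = mon q i j k m} := by
    rw [span_mon]; trivial
  induction hf using Submodule.span_induction with
  | mem x hx =>
    obtain ⟨i, j, k, m, rfl⟩ := hx
    rw [deriv_mon, map_add, map_smul, map_smul, smul_eq_mul, smul_eq_mul]
    rcases i with _ | i
    · have h : haar q (mon q 0 (j - 1) k (m + 1)) = 0 := haar_mon_eq_zero q (by omega)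
      rw [h]; simp [num]
    · rcases j with _ | j
      · rw [haar_mon_eq_zero q (j := 0) (by omega)]; simp [num]
      · simp only [Nat.add_sub_cancel]
        by_cases h : i = m ∧ j = k
        · obtain ⟨rfl, rfl⟩ := h
          exact haar_deriv_aux q j i
        · rw [haar_mon_eq_zero q (by omega), haar_mon_eq_zero q (by omega), mul_zero, mul_zero,
            add_zero]
  | zero => simp
  | add x y _ _ hx hy => rw [map_add, map_add, hx, hy, add_zero]
  | smul z x _ hx => rw [map_smul, map_smul, hx, smul_zero]

/-- The map `f ↦ (id ⊗ h)(Δ f)`. -/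
noncomputable def avg : Coord q →ₗ[ℂ] Coord q :=
  (TensorProduct.rid ℂ (Coord q)).toLinearMap ∘ₗ (haar q).lTensor (Coord q) ∘ₗ
    (comul q).toLinearMap

theorem avg_apply (f : Coord q) : avg q f =
    TensorProduct.rid ℂ (Coord q) ((haar q).lTensor (Coord q) (comul q f)) := rfl

theorem avg_deriv (f : Coord q) : avg q (deriv q f) = 0 := by
  have : haar q ∘ₗ deriv q = 0 := LinearMap.ext (haar_deriv q)
  rw [avg_apply, comul_deriv, ← LinearMap.lTensor_comp_apply, this]
  simp

theorem avg_kAut (f : Coord q) : avg q (kAut q f) = avg q f := by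
  have h1 : haar q ∘ₗ (kAut q).toLinearMap = haar q := LinearMap.ext (haar_kAut q)
  have h2 : ∀ x : Coord q ⊗[ℂ] Coord q,
      Algebra.TensorProduct.map (AlgHom.id ℂ (Coord q)) (kAut q) x =
        (kAut q).toLinearMap.lTensor (Coord q) x := fun _ => rfl
  rw [avg_apply, comul_kAut, h2, ← LinearMap.lTensor_comp_apply, h1, ← avg_apply]

/-- The elements on which right averaging agrees with the Haar functional. -/
noncomputable def good : Submodule ℂ (Coord q) :=
  LinearMap.eqLocus (avg q) ((haar q).smulRight 1)

theorem mem_good {f : Coord q} : f ∈ good q ↔ avg q f = haar q f • 1 := Iff.rfl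

theorem deriv_mem_good (f : Coord q) : deriv q f ∈ good q := by
  rw [mem_good, avg_deriv, haar_deriv, zero_smul]

theorem one_mem_good : 1 ∈ good q := by
  rw [mem_good, avg_apply, map_one, Algebra.TensorProduct.one_def, LinearMap.lTensor_tmul,
    TensorProduct.rid_tmul]

theorem mon_mem_good_of_weight {i j k m : ℕ} (h : i + j ≠ k + m) : mon q i j k m ∈ good q := by
  have h1 := avg_kAut q (mon q i j k m)
  rw [kAut_mon, map_smul] at h1
  have h3 := sub_ne_zero.2 (zpow_ne_one q (w := (i : ℤ) + j - k - m) (by omega))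
  rw [mem_good, haar_mon_weight q h, zero_smul]
  refine (smul_eq_zero.1 (?_ : (((q : ℝ) : ℂ) ^ ((i : ℤ) + j - k - m) - 1) •
    avg q (mon q i j k m) = 0)).resolve_left h3
  rw [sub_smul, h1, one_smul, sub_self]

theorem num_ne_zero (n : ℕ) : (num q (n + 1) : ℂ) ≠ 0 := by
  exact_mod_cast (num_succ_pos q n).ne'

theorem mon_mem_good_iff (i j k m : ℕ) :
    mon q i (j + 1) (k + 1) m ∈ good q ↔ mon q (i + 1) j k (m + 1) ∈ good q := by
  have h0 := Param.ne_zero q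
  have h := deriv_mem_good q (mon q (i + 1) (j + 1) k m)
  rw [deriv_mon, Nat.add_sub_cancel, Nat.add_sub_cancel] at h
  have hc : ((q : ℝ) : ℂ) ^ (i + 1) * (((q : ℝ) : ℂ)⁻¹) ^ k * num q (j + 1) ≠ 0 :=
    mul_ne_zero (mul_ne_zero (pow_ne_zero _ h0) (pow_ne_zero _ (inv_ne_zero h0))) (num_ne_zero q j)
  constructor
  · intro h'
    exact ((good q).smul_mem_iff hc).1 (((good q).add_mem_iff_right
      ((good q).smul_mem _ h')).1 h)
  · intro h'
    exact ((good q).smul_mem_iff (num_ne_zero q i)).1 (((good q).add_mem_iff_left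
      ((good q).smul_mem _ h')).1 h)

theorem mon_mem_good_left (j k m : ℕ) : mon q 0 j k (m + 1) ∈ good q := by
  have h0 := Param.ne_zero q
  have h := deriv_mem_good q (mon q 0 (j + 1) k m)
  rw [deriv_mon] at h
  simp only [num, Complex.ofReal_zero, zero_smul, zero_add, Nat.add_sub_cancel, pow_zero,
    one_mul] at h
  exact ((good q).smul_mem_iff (mul_ne_zero (pow_ne_zero _ (inv_ne_zero h0))
    (num_ne_zero q j))).1 h

theorem mon_mem_good_right (i k m : ℕ) : mon q i 0 (k + 1) m ∈ good q := by
  have h := deriv_mem_good q (mon q (i + 1) 0 k m)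
  rw [deriv_mon] at h
  simp only [num.eq_1, Complex.ofReal_zero, zero_smul, add_zero, mul_zero,
    Nat.add_sub_cancel] at h
  exact ((good q).smul_mem_iff (num_ne_zero q i)).1 h

theorem mon_mem_good_lt (i : ℕ) : ∀ j k m, i < m → mon q i j k m ∈ good q := by
  induction i with
  | zero =>
    intro j k m h
    obtain ⟨m, rfl⟩ := Nat.exists_eq_succ_of_ne_zero h.ne'
    exact mon_mem_good_left q j k m
  | succ i ih =>
    intro j k m h
    obtain ⟨m, rfl⟩ := Nat.exists_eq_succ_of_ne_zero (Nat.ne_zero_of_lt h)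
    exact (mon_mem_good_iff q i j k m).1 (ih _ _ _ (by omega))

theorem mon_mem_good_gt (j : ℕ) : ∀ i k m, j < k → mon q i j k m ∈ good q := by
  induction j with
  | zero =>
    intro i k m h
    obtain ⟨k, rfl⟩ := Nat.exists_eq_succ_of_ne_zero h.ne'
    exact mon_mem_good_right q i k m
  | succ j ih =>
    intro i k m h
    obtain ⟨k, rfl⟩ := Nat.exists_eq_succ_of_ne_zero (Nat.ne_zero_of_lt h)
    exact (mon_mem_good_iff q i j k m).2 (ih _ _ _ (by omega))

theorem mon_split (n : ℕ) : mon q 0 n n 0 =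
    (((q : ℝ) : ℂ)⁻¹ ^ n * ((q : ℝ) : ℂ)⁻¹ ^ n) • mon q 1 n n 1 -
      ((q : ℝ) : ℂ) • mon q 0 (n + 1) (n + 1) 0 := by
  have h1 : (1 : Coord q) = gen q .a * gen q .d - ((q : ℝ) : ℂ) • (gen q .c * gen q .b) := by
    rw [gen_ad, gen_bc, add_sub_cancel_right]
  have h2 : mon q 0 n n 0 = gen q .c ^ n * 1 * gen q .b ^ n := by simp [mon]
  rw [h2, h1, mul_sub, sub_mul]
  congr 1
  · rw [← mul_assoc, pow_gen_ca, mul_assoc, pow_gen_bd, smul_mul_smul_comm, mon, pow_one, pow_one]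
    simp only [mul_assoc]
  · rw [mul_smul_comm, smul_mul_assoc, mon, pow_zero, pow_zero, mul_one, one_mul, pow_succ,
      pow_succ']
    simp only [mul_assoc]

theorem mon_mem_good_diag (n : ℕ) : mon q 0 n n 0 ∈ good q := by
  have h0 := Param.ne_zero q
  induction n with
  | zero => simpa [mon] using one_mem_good q
  | succ n ih =>
    have h := deriv_mem_good q (mon q 1 (n + 1) n 0)
    have hs := mon_split q n
    rw [deriv_mon] at h
    simp only [Nat.sub_self, Nat.add_sub_cancel, zero_add] at h
    have hn : num q 1 = 1 := by simp [num]
    set c : ℝ := (q : ℝ) * ((q : ℝ)⁻¹) ^ n * num q (n + 1) with hc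
    have hq := q.2.1
    have hcpos : 0 < c := by have := num_succ_pos q n; positivity
    have hcC : ((q : ℝ) : ℂ) ^ 1 * ((q : ℝ) : ℂ)⁻¹ ^ n * (num q (n + 1) : ℂ) = (c : ℂ) := by
      rw [hc]; push_cast; ring
    rw [hcC, hn, Complex.ofReal_one, one_smul] at h
    set r : ℝ := (q : ℝ)⁻¹ ^ n * (q : ℝ)⁻¹ ^ n with hr
    have hrC : ((q : ℝ) : ℂ)⁻¹ ^ n * ((q : ℝ) : ℂ)⁻¹ ^ n = (r : ℂ) := by rw [hr]; push_cast; ring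
    rw [hrC] at hs
    have hcomb : ((r + c * q : ℝ) : ℂ) • mon q 0 (n + 1) (n + 1) 0 =
        (r : ℂ) • (mon q 0 (n + 1) (n + 1) 0 + (c : ℂ) • mon q 1 n n 1) -
          (c : ℂ) • mon q 0 n n 0 := by
      rw [hs]; push_cast; module
    have hpos : ((r + c * q : ℝ) : ℂ) ≠ 0 := by
      have : 0 < r + c * q := by positivity
      exact_mod_cast this.ne'
    refine ((good q).smul_mem_iff hpos).1 ?_
    rw [hcomb]
    exact (good q).sub_mem ((good q).smul_mem _ h) ((good q).smul_mem _ ih)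

theorem mon_mem_good_mid (i : ℕ) : ∀ j, mon q i j j i ∈ good q := by
  induction i with
  | zero => exact mon_mem_good_diag q
  | succ i ih => exact fun j => (mon_mem_good_iff q i j j i).1 (ih _)

theorem good_eq_top : good q = ⊤ := by
  rw [eq_top_iff, ← span_mon, Submodule.span_le]
  rintro _ ⟨i, j, k, m, rfl⟩
  show mon q i j k m ∈ good q
  by_cases h : i + j = k + m
  · rcases lt_trichotomy i m with h1 | h1 | h1
    · exact mon_mem_good_lt q i j k m h1
    · obtain rfl : j = k := by omega
      subst h1
      exact mon_mem_good_mid q i j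
    · exact mon_mem_good_gt q j i k m (by omega)
  · exact mon_mem_good_of_weight q h

theorem comul_flipAut (f : Coord q) : comul q (flipAut q f) =
    TensorProduct.comm ℂ (Coord q) (Coord q)
      (TensorProduct.map (flipAut q).toLinearMap (flipAut q).toLinearMap (comul q f)) := by
  have : (comul q).comp (flipAut q) = ((Algebra.TensorProduct.comm ℂ (Coord q) (Coord q)).toAlgHom.comp
      (Algebra.TensorProduct.map (flipAut q) (flipAut q))).comp (comul q) := by
    refine AlgHom.ext fun f => ?_
    induction f using Coord.induction with
    | hC z => simp only [AlgHom.commutes]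
    | hg g => cases g <;> simp [comul, flipAut]
    | hadd f g hf hg => rw [map_add, map_add, hf, hg]
    | hmul f g hf hg => rw [map_mul, map_mul, hf, hg]
  exact DFunLike.congr_fun this f

/-- The functional `haar` is the Haar functional of `SU_q(2)`. -/
theorem haar_isHaarFunctional : IsHaarFunctional (haar q) := by
  have hgood : ∀ f : Coord q, avg q f = haar q f • 1 := fun f => by
    rw [← mem_good, good_eq_top]; trivial
  intro f
  refine ⟨hgood f, ?_⟩
  have hff : ∀ f, flipAut q (flipAut q f) = f := by
    intro f
    induction f using Coord.induction with
    | hC z => simp only [AlgHom.commutes]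
    | hg g => cases g <;> simp [flipAut]
    | hadd f g hf hg => simp only [map_add, hf, hg]
    | hmul f g hf hg => simp only [map_mul, hf, hg]
  have key : ∀ x : Coord q ⊗[ℂ] Coord q,
      flipAut q (TensorProduct.rid ℂ (Coord q) ((haar q).lTensor (Coord q)
        (TensorProduct.comm ℂ (Coord q) (Coord q)
          (TensorProduct.map (flipAut q).toLinearMap (flipAut q).toLinearMap x)))) =
      TensorProduct.lid ℂ (Coord q) ((haar q).rTensor (Coord q) x) := by
    intro x
    induction x with
    | zero => simp
    | add x y hx hy => simp only [map_add, hx, hy]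
    | tmul x y => simp [haar_flipAut, hff]
  rw [← key, ← comul_flipAut, ← avg_apply, hgood, haar_flipAut, map_smul, map_one]

end Invariance

/-! ### The Hilbert space -/

/-- The coordinate algebra with the inner product `⟨y, x⟩ = h(x y*)`. -/
def PreL2 (q : Param) : Type := Coord q

noncomputable instance (q : Param) : AddCommGroup (PreL2 q) :=
  inferInstanceAs (AddCommGroup (Coord q))

noncomputable instance (q : Param) : Module ℂ (PreL2 q) := inferInstanceAs (Module ℂ (Coord q))

/-- The identity map to `PreL2`. -/
noncomputable def toPreL2 (q : Param) : Coord q ≃ₗ[ℂ] PreL2 q := LinearEquiv.refl ℂ (Coord q)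

/-- The inner product `⟨y, x⟩ = h(x y*)`. -/
noncomputable abbrev innerCore (q : Param) : PreInnerProductSpace.Core ℂ (PreL2 q) where
  inner y x := haar q ((toPreL2 q).symm x * star ((toPreL2 q).symm y))
  conj_inner_symm x y := by rw [← haar_star, star_mul, star_star]
  re_inner_nonneg x := haar_mul_star_nonneg q _
  add_left x y z := by rw [map_add, star_add, mul_add, map_add]
  smul_left x y z := by
    rw [map_smul, star_smul, mul_smul_comm, map_smul, smul_eq_mul]; rfl

noncomputable instance (q : Param) : SeminormedAddCommGroup (PreL2 q) :=
  @InnerProductSpace.Core.toSeminormedAddCommGroup ℂ (PreL2 q) _ _ _ (innerCore q)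

noncomputable instance (q : Param) : InnerProductSpace ℂ (PreL2 q) :=
  InnerProductSpace.ofCore (innerCore q)

/-- The completion of the coordinate algebra for the norm `‖f‖ = h(f f*)^(1/2)`. -/
abbrev L2 (q : Param) : Type := UniformSpace.Completion (PreL2 q)

/-- The canonical map of the coordinate algebra to its completion. -/
noncomputable def toL2 (q : Param) : Coord q →ₗ[ℂ] L2 q :=
  (UniformSpace.Completion.toComplL (𝕜 := ℂ) (E := PreL2 q)).toLinearMap ∘ₗ
    (toPreL2 q).toLinearMap

theorem inner_toL2 (q : Param) (x y : Coord q) :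
    inner ℂ (toL2 q y) (toL2 q x) = haar q (x * star y) :=
  UniformSpace.Completion.inner_coe (𝕜 := ℂ) (E := PreL2 q) _ _

theorem norm_toL2 (q : Param) (x : Coord q) : ‖toL2 q x‖ = √(haar q (x * star x)).re := by
  rw [norm_eq_sqrt_re_inner (𝕜 := ℂ), inner_toL2]; rfl

/-! ### The irreducible corepresentations -/

/-- The generators of the quantum plane. -/
inductive PlaneGen
  | x | y

open FreeAlgebra in
/-- The relation `x y = q y x` of the quantum plane. -/
inductive PlaneRel (q : Param) : FreeAlgebra ℂ PlaneGen → FreeAlgebra ℂ PlaneGen → Prop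
  | xy : PlaneRel q (ι ℂ PlaneGen.x * ι ℂ PlaneGen.y)
      (((q : ℝ) : ℂ) • (ι ℂ PlaneGen.y * ι ℂ PlaneGen.x))

/-- The quantum plane. -/
def Plane (q : Param) : Type := RingQuot (PlaneRel q)

noncomputable instance (q : Param) : Ring (Plane q) :=
  inferInstanceAs (Ring (RingQuot (PlaneRel q)))

noncomputable instance (q : Param) : Algebra ℂ (Plane q) :=
  inferInstanceAs (Algebra ℂ (RingQuot (PlaneRel q)))

/-- The class of a generator of the quantum plane. -/
noncomputable def planeGen (q : Param) (g : PlaneGen) : Plane q :=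
  RingQuot.mkAlgHom ℂ (PlaneRel q) (FreeAlgebra.ι ℂ g)

theorem planeGen_xy (q : Param) :
    planeGen q .x * planeGen q .y = ((q : ℝ) : ℂ) • (planeGen q .y * planeGen q .x) := by
  have := RingQuot.mkAlgHom_rel ℂ (PlaneRel.xy (q := q))
  rw [map_smul, map_mul, map_mul] at this
  exact this

/-- The right coaction on generators, `R x = x ⊗ a + y ⊗ c`, `R y = x ⊗ b + y ⊗ d`. -/
noncomputable def coactionGen (q : Param) : PlaneGen → Plane q ⊗[ℂ] Coord q
  | .x => planeGen q .x ⊗ₜ gen q .a + planeGen q .y ⊗ₜ gen q .c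
  | .y => planeGen q .x ⊗ₜ gen q .b + planeGen q .y ⊗ₜ gen q .d

/-- The right coaction of `SU_q(2)` on the quantum plane. -/
noncomputable def coaction (q : Param) : Plane q →ₐ[ℂ] Plane q ⊗[ℂ] Coord q :=
  RingQuot.liftAlgHom ℂ ⟨FreeAlgebra.lift ℂ (coactionGen q), by
    rintro _ _ ⟨⟩
    have h0 := Param.ne_zero q
    simp only [map_mul, map_smul, FreeAlgebra.lift_ι_apply, coactionGen, mul_add, add_mul,
      Algebra.TensorProduct.tmul_mul_tmul, gen_ab, gen_cd,
      gen_ad, gen_da, gen_bc, planeGen_xy, TensorProduct.tmul_add,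
      TensorProduct.tmul_smul, ← TensorProduct.smul_tmul', smul_add, smul_smul]
    match_scalars <;> (try field_simp)⟩

theorem coaction_gen (q : Param) (g : PlaneGen) :
    coaction q (planeGen q g) = coactionGen q g := by
  unfold coaction planeGen
  exact (RingQuot.liftAlgHom_mkAlgHom_apply ℂ _ _ _).trans (FreeAlgebra.lift_ι_apply _ _)

/-- If `w` lists the coefficients of `∑ᵢ x^(n-i) y^i ⊗ wᵢ`, this lists the coefficients of its
product with `x ⊗ u + y ⊗ v`. -/
noncomputable def stepRow (q : Param) (u v : Coord q) (w : ℕ → Coord q) : ℕ → Coord q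
  | 0 => w 0 * u
  | i + 1 => (((q : ℝ) : ℂ)⁻¹) ^ (i + 1) • (w (i + 1) * u) + w i * v

/-- The coefficients of `R(x^k y^j) = ∑ᵢ x^(k+j-i) y^i ⊗ rowCoef k j i`. -/
noncomputable def rowCoef (q : Param) (k j : ℕ) : ℕ → Coord q :=
  (stepRow q (gen q .b) (gen q .d))^[j]
    ((stepRow q (gen q .a) (gen q .c))^[k] (Pi.single 0 1))

theorem plane_yx (q : Param) (i : ℕ) : planeGen q .y ^ i * planeGen q .x =
    (((q : ℝ) : ℂ)⁻¹) ^ i • (planeGen q .x * planeGen q .y ^ i) := by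
  have h0 := Param.ne_zero q
  have h : planeGen q .y * planeGen q .x =
      ((q : ℝ) : ℂ)⁻¹ • (planeGen q .x * planeGen q .y) := by
    rw [planeGen_xy, smul_smul, inv_mul_cancel₀ h0, one_smul]
  induction i with
  | zero => simp
  | succ n ih =>
    rw [pow_succ, mul_assoc, h, mul_smul_comm, ← mul_assoc, ih, smul_mul_assoc, smul_smul,
      mul_assoc, ← pow_succ, ← pow_succ', pow_succ]

theorem stepRow_spec (q : Param) (u v : Coord q) (w : ℕ → Coord q) (n : ℕ)
    (hw : ∀ i, n < i → w i = 0) :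
    (∑ i ∈ Finset.range (n + 1), (planeGen q .x ^ (n - i) * planeGen q .y ^ i) ⊗ₜ[ℂ] w i) *
        (planeGen q .x ⊗ₜ u + planeGen q .y ⊗ₜ v) =
      (∑ i ∈ Finset.range (n + 2),
        (planeGen q .x ^ (n + 1 - i) * planeGen q .y ^ i) ⊗ₜ[ℂ] stepRow q u v w i) ∧
    ∀ i, n + 1 < i → stepRow q u v w i = 0 := by
  constructor
  · have h1 : ∀ i ∈ Finset.range (n + 1), (planeGen q .x ^ (n - i) * planeGen q .y ^ i) ⊗ₜ[ℂ] w i *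
        (planeGen q .x ⊗ₜ u + planeGen q .y ⊗ₜ v) =
        (planeGen q .x ^ (n + 1 - i) * planeGen q .y ^ i) ⊗ₜ[ℂ]
          ((((q : ℝ) : ℂ)⁻¹) ^ i • (w i * u)) +
        (planeGen q .x ^ (n + 1 - (i + 1)) * planeGen q .y ^ (i + 1)) ⊗ₜ[ℂ] (w i * v) := by
      intro i hi
      have hi' : n + 1 - i = (n - i) + 1 := by have := Finset.mem_range.1 hi; omega
      rw [mul_add, Algebra.TensorProduct.tmul_mul_tmul, Algebra.TensorProduct.tmul_mul_tmul,
        mul_assoc, plane_yx, mul_smul_comm, ← mul_assoc, ← pow_succ, mul_assoc, ← pow_succ,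
        TensorProduct.tmul_smul, TensorProduct.smul_tmul', hi', Nat.add_sub_add_right]
    rw [Finset.sum_mul, Finset.sum_congr rfl h1, Finset.sum_add_distrib]
    have h2 : ∑ i ∈ Finset.range (n + 1), (planeGen q .x ^ (n + 1 - i) * planeGen q .y ^ i) ⊗ₜ[ℂ]
          ((((q : ℝ) : ℂ)⁻¹) ^ i • (w i * u)) =
        ∑ i ∈ Finset.range (n + 2), (planeGen q .x ^ (n + 1 - i) * planeGen q .y ^ i) ⊗ₜ[ℂ]
          ((((q : ℝ) : ℂ)⁻¹) ^ i • (w i * u)) := by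
      rw [Finset.sum_range_succ _ (n + 1), hw (n + 1) (Nat.lt_succ_self n)]; simp
    rw [h2, Finset.sum_range_succ' _ (n + 1), Finset.sum_range_succ' _ (n + 1),
      add_right_comm, ← Finset.sum_add_distrib]
    simp only [← TensorProduct.tmul_add, stepRow, pow_zero, one_smul]
  · intro i hi
    obtain ⟨i, rfl⟩ := Nat.exists_eq_succ_of_ne_zero (Nat.ne_zero_of_lt hi)
    rw [stepRow, hw (i + 1) (by omega), hw i (by omega)]; simp

theorem coaction_monomial (q : Param) (k j : ℕ) :
    coaction q (planeGen q .x ^ k * planeGen q .y ^ j) =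
      (∑ i ∈ Finset.range (k + j + 1),
        (planeGen q .x ^ (k + j - i) * planeGen q .y ^ i) ⊗ₜ[ℂ] rowCoef q k j i) ∧
    ∀ i, k + j < i → rowCoef q k j i = 0 := by
  induction j with
  | zero =>
    induction k with
    | zero =>
      refine ⟨by simp [rowCoef, Algebra.TensorProduct.one_def], fun i hi => ?_⟩
      simp [rowCoef, Nat.ne_zero_of_lt hi]
    | succ k ih =>
      obtain ⟨ih1, ih2⟩ := ih
      have hs := stepRow_spec q (gen q .a) (gen q .c) _ (k + 0) ih2
      have hr : rowCoef q (k + 1) 0 = stepRow q (gen q .a) (gen q .c) (rowCoef q k 0) := by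
        simp only [rowCoef, Function.iterate_zero, id, Function.iterate_succ_apply']
      rw [hr]
      refine ⟨?_, hs.2⟩
      rw [← ih1] at hs
      refine Eq.trans ?_ hs.1
      rw [pow_zero, mul_one, mul_one, pow_succ, map_mul, coaction_gen]; rfl
  | succ j ih =>
    obtain ⟨ih1, ih2⟩ := ih
    have hs := stepRow_spec q (gen q .b) (gen q .d) _ (k + j) ih2
    have hr : rowCoef q k (j + 1) = stepRow q (gen q .b) (gen q .d) (rowCoef q k j) := by
      simp only [rowCoef, Function.iterate_succ_apply']
    rw [hr]
    refine ⟨?_, hs.2⟩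
    rw [← ih1] at hs
    refine Eq.trans ?_ hs.1
    rw [pow_succ, ← mul_assoc, map_mul, coaction_gen]; rfl

/-- The Gaussian binomial coefficient. -/
noncomputable def gaussBinom (p : ℝ) (n k : ℕ) : ℝ :=
  ∏ s ∈ Finset.range k, (1 - p ^ (n - s)) / (1 - p ^ (s + 1))

/-- The normalization of the monomials that makes the corepresentations unitary. -/
noncomputable def normalizer (q : Param) (n k : ℕ) : ℝ := √(gaussBinom ((q : ℝ) ^ 2)⁻¹ n k)

theorem normalizer_pos (q : Param) {n k : ℕ} (h : k ≤ n) : 0 < normalizer q n k := by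
  have hp : 1 < ((q : ℝ) ^ 2)⁻¹ :=
    (one_lt_inv₀ (pow_pos q.2.1 _)).2 (pow_lt_one₀ q.2.1.le q.2.2 two_ne_zero)
  refine Real.sqrt_pos.2 (Finset.prod_pos fun s hs => ?_)
  have hs' := Finset.mem_range.1 hs
  exact div_pos_of_neg_of_neg (sub_neg.2 (one_lt_pow₀ hp (by omega)))
    (sub_neg.2 (one_lt_pow₀ hp (by omega)))

/-- The normalized basis of the polynomials of degree `n = 2l` in the quantum plane; `k` stands
for the index `-l + k`. -/
noncomputable def planeBasis (q : Param) (n : ℕ) (k : Fin (n + 1)) : Plane q :=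
  (normalizer q n k : ℂ) • (planeGen q .x ^ (n - k : ℕ) * planeGen q .y ^ (k : ℕ))

/-- The matrix coefficients of the irreducible corepresentation `T^(l)`, `n = 2l`; the indices
`i j` stand for `-l + i`, `-l + j`. See `coaction_planeBasis`. -/
noncomputable def matCoef (q : Param) (n : ℕ) (i j : Fin (n + 1)) : Coord q :=
  ((normalizer q n j / normalizer q n i : ℝ) : ℂ) • rowCoef q (n - j) j i

theorem coaction_planeBasis (q : Param) (n : ℕ) (j : Fin (n + 1)) :
    coaction q (planeBasis q n j) = ∑ i, planeBasis q n i ⊗ₜ[ℂ] matCoef q n i j := by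
  have h := (coaction_monomial q (n - j) j).1
  rw [Nat.sub_add_cancel (Nat.lt_succ_iff.1 j.2), Finset.sum_range] at h
  rw [planeBasis, map_smul, h, Finset.smul_sum]
  refine Finset.sum_congr rfl fun i _ => ?_
  have hi : (normalizer q n i : ℂ) ≠ 0 := by
    exact_mod_cast (normalizer_pos q (Nat.lt_succ_iff.1 i.2)).ne'
  rw [planeBasis, matCoef, TensorProduct.tmul_smul, ← TensorProduct.smul_tmul', smul_smul]
  congr 1
  push_cast
  field_simp

/-! ### Fourier transform and pseudo-differential operators

A half-integer `l ∈ ½ℕ` is encoded by `n = 2l : ℕ`, and an index `-l ≤ i ≤ l` by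
`i + l ∈ {0, …, n}`. -/

/-- The `q`-number `[n]_q`. -/
noncomputable def qNumber (q : Param) (n : ℕ) : ℂ :=
  ((((q : ℝ) ^ n - ((q : ℝ)⁻¹) ^ n) / ((q : ℝ) - (q : ℝ)⁻¹) : ℝ) : ℂ)

/-- The Fourier transform `f̂(l)_{rs} = h(f (t_{sr})*)`. -/
noncomputable def fourier (q : Param) (n : ℕ) :
    L2 q →ₗ[ℂ] Matrix (Fin (n + 1)) (Fin (n + 1)) ℂ where
  toFun f := Matrix.of fun r s => inner ℂ (toL2 q (matCoef q n s r)) f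
  map_add' f g := by ext; simp [inner_add_right]
  map_smul' z f := by ext; simp [inner_smul_right]

theorem fourier_toL2 (q : Param) (n : ℕ) (f : Coord q) (r s : Fin (n + 1)) :
    fourier q n (toL2 q f) r s = haar q (f * star (matCoef q n s r)) := inner_toL2 q _ _

/-- The quantum trace `Tr_q(A) = ∑ⱼ q^(-2j) A_{jj}`, over `-l ≤ j ≤ l`. -/
noncomputable def qTrace (q : Param) (n : ℕ) :
    Matrix (Fin (n + 1)) (Fin (n + 1)) (Coord q) →ₗ[ℂ] Coord q where
  toFun A := ∑ j : Fin (n + 1), ((q : ℝ) : ℂ) ^ ((n : ℤ) - 2 * (j : ℕ)) • A j j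
  map_add' A B := by simp [Finset.sum_add_distrib, -Complex.coe_smul]
  map_smul' z A := by
    simp only [Matrix.smul_apply, RingHom.id_apply, Finset.smul_sum]
    exact Finset.sum_congr rfl fun j _ => smul_comm _ _ _

/-- A symbol: for each `l`, a matrix of size `2l + 1` over the coordinate algebra. -/
abbrev Symbol (q : Param) : Type :=
  (n : ℕ) → Matrix (Fin (n + 1)) (Fin (n + 1)) (Coord q)

/-- The term of `T_σ f` of index `l`, `[2l+1]_q Tr_q(σ(l) f̂(l) T^(l))`. -/
noncomputable def symbolTerm {q : Param} (σ : Symbol q) (f : L2 q) (n : ℕ) : L2 q :=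
  toL2 q (qNumber q (n + 1) •
    qTrace q n (σ n * (fourier q n f).map (algebraMap ℂ (Coord q)) * Matrix.of (matCoef q n)))

theorem symbolTerm_add {q : Param} (σ : Symbol q) (f g : L2 q) (n : ℕ) :
    symbolTerm σ (f + g) n = symbolTerm σ f n + symbolTerm σ g n := by
  have : (fourier q n (f + g)).map (algebraMap ℂ (Coord q)) =
      (fourier q n f).map (algebraMap ℂ (Coord q)) +
        (fourier q n g).map (algebraMap ℂ (Coord q)) := by
    rw [map_add, Matrix.map_add _ (map_add _)]
  rw [symbolTerm, this, Matrix.mul_add, Matrix.add_mul, map_add, smul_add, map_add]; rfl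

theorem symbolTerm_smul {q : Param} (σ : Symbol q) (z : ℂ) (f : L2 q) (n : ℕ) :
    symbolTerm σ (z • f) n = z • symbolTerm σ f n := by
  have : (fourier q n (z • f)).map (algebraMap ℂ (Coord q)) =
      z • (fourier q n f).map (algebraMap ℂ (Coord q)) := by
    ext i j
    rw [map_smul, Matrix.map_apply, Matrix.smul_apply, Matrix.smul_apply, Matrix.map_apply,
      smul_eq_mul, map_mul, ← Algebra.smul_def]
  rw [symbolTerm, this, Matrix.mul_smul, Matrix.smul_mul, map_smul (qTrace q n),
    smul_comm, map_smul (toL2 q) z]; rfl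

/-- The global pseudo-differential operator `T_σ f = ∑_l [2l+1]_q Tr_q(σ(l) f̂(l) T^(l))`,
that is, the inverse Fourier transform of `σ f̂`, on the domain of all `f` for which the series
converges. -/
noncomputable def psiDO {q : Param} (σ : Symbol q) : L2 q →ₗ.[ℂ] L2 q where
  domain :=
    { carrier := {f | Summable (symbolTerm σ f)}
      zero_mem' := by
        have : symbolTerm σ (0 : L2 q) = 0 := by
          ext1 n
          rw [← zero_smul ℂ (0 : L2 q), symbolTerm_smul, zero_smul]; rfl
        show Summable (symbolTerm σ (0 : L2 q))
        rw [this]; exact summable_zero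
      add_mem' := fun {f g} hf hg => by
        show Summable (symbolTerm σ (f + g))
        rw [show symbolTerm σ (f + g) = symbolTerm σ f + symbolTerm σ g from
          funext fun n => symbolTerm_add σ f g n]
        exact Summable.add hf hg
      smul_mem' := fun z f hf => by
        show Summable (symbolTerm σ (z • f))
        rw [show symbolTerm σ (z • f) = z • symbolTerm σ f from
          funext fun n => symbolTerm_smul σ z f n]
        exact Summable.const_smul z hf }
  toFun :=
    { toFun := fun f => ∑' n, symbolTerm σ (f : L2 q) n
      map_add' := fun f g => by
        simp only [Submodule.coe_add, symbolTerm_add]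
        exact Summable.tsum_add f.2 g.2
      map_smul' := fun z f => by
        simp only [Submodule.coe_smul, symbolTerm_smul, RingHom.id_apply]
        exact Summable.tsum_const_smul z f.2 }

/-- Homogeneous symbols of Fourier order `m / 2`: each entry `σ(l)_{ij}` is a multiple of
`t^(m/2)_{ψ(l)(i,j)}` for a map `ψ(l)` to pairs of half-integers (here doubled), and zero if
`ψ(l)(i,j)` is not a pair of indices of `T^(m/2)`. -/
def IsHomogeneous {q : Param} (m : ℕ) (σ : Symbol q) : Prop :=
  ∃ ψ : (n : ℕ) → Fin (n + 1) × Fin (n + 1) → ℤ × ℤ, ∀ (n : ℕ) (i j : Fin (n + 1)),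
    (∀ r s : Fin (m + 1), ψ n (i, j) = (2 * (r : ℤ) - m, 2 * (s : ℤ) - m) →
      σ n i j ∈ Submodule.span ℂ {matCoef q m r s}) ∧
    ((∀ r s : Fin (m + 1), ψ n (i, j) ≠ (2 * (r : ℤ) - m, 2 * (s : ℤ) - m)) → σ n i j = 0)

/-- The class `Φ^(m/2)` of symbols of Fourier order `m / 2`: finite linear combinations of
homogeneous symbols. -/
noncomputable def symbolClass (q : Param) (m : ℕ) : Submodule ℂ (Symbol q) :=
  Submodule.span ℂ {σ | IsHomogeneous m σ}

/-! ### Spectrum and multiplicity -/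

/-- The spectrum of a partially defined operator: `z` is outside of it if `T - z` has a bounded
everywhere defined inverse. -/
def pmapSpectrum {H : Type*} [NormedAddCommGroup H] [NormedSpace ℂ H] (T : H →ₗ.[ℂ] H) : Set ℂ :=
  {z | ¬ ∃ R : H →L[ℂ] H,
    (∀ g, ∃ hg : R g ∈ T.domain, T ⟨R g, hg⟩ - z • R g = g) ∧
    ∀ f : T.domain, R (T f - z • (f : H)) = f}

/-- The eigenspace `ker (T - z)` of a partially defined operator. -/
def pmapEigenspace {H : Type*} [NormedAddCommGroup H] [NormedSpace ℂ H] (T : H →ₗ.[ℂ] H) (z : ℂ) :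
    Submodule ℂ H :=
  (LinearMap.ker (T.toFun - z • T.domain.subtype)).map T.domain.subtype

theorem mem_pmapEigenspace {H : Type*} [NormedAddCommGroup H] [NormedSpace ℂ H]
    (T : H →ₗ.[ℂ] H) (z : ℂ) (f : H) :
    f ∈ pmapEigenspace T z ↔ ∃ hf : f ∈ T.domain, T ⟨f, hf⟩ = z • f := by
  constructor
  · rintro ⟨⟨g, hg⟩, hgz, rfl⟩
    exact ⟨hg, sub_eq_zero.1 hgz⟩
  · rintro ⟨hf, h⟩
    exact ⟨⟨f, hf⟩, sub_eq_zero.2 h, rfl⟩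

end SUq2

/-
Write `l = n / 2`. The raising operator `E` satisfies `h ∘ E = 0` and sends the `j`-th column of
`T^(l)` to a multiple of the `(j+1)`-th, so a twisted integration by parts reduces every Haar inner
product of matrix coefficients to one in the first column, whose entries are multiples of the
monomials `a^(n-i) c^i`. This gives Schur orthogonality, and with it Fourier inversion:
`A ↦ [2l+1]_q Tr_q(A T^(l))` is injective on scalar matrices, and its values have Fourier transform
`A` in degree `l` and `0` elsewhere. Hence, if a scalar vector `v` satisfies `σ(l) v = z v`, then
`T_σ` multiplies by `z` the image of each `A = v wᵀ`, a space of dimension `2l + 1`. Row sums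
`λ(l)` mean that `v = (1, …, 1)` has eigenvalue `λ(l)`.
-/

namespace SUq2

section StepRow
variable (q : Param)

theorem stepRow_smul (u v : Coord q) (z : ℂ) (w : ℕ → Coord q) :
    stepRow q u v (z • w) = z • stepRow q u v w := by
  ext (_ | i)
  · simp only [stepRow, Pi.smul_apply, smul_mul_assoc]
  · simp only [stepRow, Pi.smul_apply, smul_mul_assoc, smul_add, smul_comm z]

theorem stepRow_smul_smul (z : ℂ) (u v : Coord q) (w : ℕ → Coord q) :
    stepRow q (z • u) (z • v) w = z • stepRow q u v w := by
  ext (_ | i)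
  · simp only [stepRow, Pi.smul_apply, mul_smul_comm]
  · simp only [stepRow, Pi.smul_apply, mul_smul_comm, smul_add, smul_comm z]

theorem stepRow_zero_zero (w : ℕ → Coord q) : stepRow q 0 0 w = 0 := by
  simpa only [zero_smul] using stepRow_smul_smul q 0 0 0 w

theorem stepRow_zero_right (u v : Coord q) : stepRow q u v 0 = 0 := by
  simpa only [zero_smul] using stepRow_smul q u v 0 0

/- The relation `y x = q⁻¹ x y` of the quantum plane, transported by the coaction. -/
theorem stepRow_ac_stepRow_bd (w : ℕ → Coord q) :
    stepRow q (gen q .a) (gen q .c) (stepRow q (gen q .b) (gen q .d) w) =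
      ((q : ℝ) : ℂ)⁻¹ • stepRow q (gen q .b) (gen q .d) (stepRow q (gen q .a) (gen q .c) w) := by
  have h0 := Param.ne_zero q
  have hba := gen_inv_comm (gen_ab q)
  have hdc := gen_inv_comm (gen_cd q)
  ext (_ | _ | i)
  · simp only [stepRow, Pi.smul_apply, mul_assoc, hba, mul_smul_comm]
  all_goals
    simp only [stepRow, Pi.smul_apply, mul_assoc, hba, hdc, gen_da, gen_ad, gen_bc, add_mul,
      mul_add, mul_one, smul_mul_assoc, mul_smul_comm, inv_pow]
    match_scalars <;> field_simp
    ring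

theorem kAut_comp_stepRow {u v : Coord q} {w : ℕ → Coord q} {y z : ℂ} (hu : kAut q u = y • u)
    (hv : kAut q v = y • v) (hw : kAut q ∘ w = z • w) :
    kAut q ∘ stepRow q u v w = (z * y) • stepRow q u v w := by
  have hw' (i : ℕ) : kAut q (w i) = z • w i := congrFun hw i
  ext (_ | i) <;>
    simp only [stepRow, Function.comp_apply, Pi.smul_apply, map_add, map_mul, map_smul, hu, hv,
      hw', smul_mul_smul_comm, smul_add, smul_comm (z * y)]

theorem deriv_comp_stepRow (u v : Coord q) {w : ℕ → Coord q} {z : ℂ} (hw : kAut q ∘ w = z • w) :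
    deriv q ∘ stepRow q u v w =
      z • stepRow q (deriv q u) (deriv q v) w + stepRow q u v (deriv q ∘ w) := by
  have hw' (i : ℕ) : kAut q (w i) = z • w i := congrFun hw i
  ext (_ | i) <;>
    simp only [stepRow, Function.comp_apply, Pi.add_apply, Pi.smul_apply, map_add, map_smul,
      deriv_mul, hw', smul_mul_assoc]
  module

end StepRow

section Lowering
variable (q : Param)

/-- The lowering operator `F f = (E (f*))*`, where `E` is the raising operator `deriv`. Up to the
torus action and a sign it is the adjoint of `E` for the Haar inner product. -/
noncomputable def lowering : Coord q →ₗ[ℂ] Coord q where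
  toFun f := star (deriv q (star f))
  map_add' f g := by simp only [star_add, map_add]
  map_smul' z f := by simp only [star_smul, map_smul, star_star, RingHom.id_apply]

theorem lowering_apply (f : Coord q) : lowering q f = star (deriv q (star f)) := rfl

theorem lowering_mul (f g : Coord q) :
    lowering q (f * g) = lowering q f * star (kAut q (star g)) + f * lowering q g := by
  simp only [lowering_apply, star_mul, deriv_mul, star_add, star_star]

theorem lowering_one : lowering q 1 = 0 := by
  rw [lowering_apply, star_one, deriv_one, star_zero]

theorem lowering_gen : lowering q (gen q .a) = 0 ∧
    lowering q (gen q .b) = -((q : ℝ) : ℂ) • gen q .a ∧ lowering q (gen q .c) = 0 ∧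
    lowering q (gen q .d) = -((q : ℝ) : ℂ) • gen q .c := by
  obtain ⟨ea, eb, ec, ed⟩ := deriv_gen q
  simp [lowering_apply, star_gen, genStar, ea, eb, ec, ed, -Complex.coe_smul]

theorem star_kAut_star_gen :
    star (kAut q (star (gen q .a))) = ((q : ℝ) : ℂ)⁻¹ • gen q .a ∧
    star (kAut q (star (gen q .b))) = ((q : ℝ) : ℂ) • gen q .b ∧
    star (kAut q (star (gen q .c))) = ((q : ℝ) : ℂ)⁻¹ • gen q .c ∧
    star (kAut q (star (gen q .d))) = ((q : ℝ) : ℂ) • gen q .d := by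
  have h0 := Param.ne_zero q
  obtain ⟨ka, kb, kc, kd⟩ := kAut_gen q
  simp only [star_gen, genStar, map_smul, ka, kb, kc, kd, star_smul', map_mul, map_neg, map_inv₀,
    Complex.conj_ofReal, smul_smul]
  refine ⟨trivial, ?_, ?_, trivial⟩ <;> congr 1 <;> field_simp

theorem lowering_comp_stepRow {u v : Coord q} {y : ℂ} (hu : star (kAut q (star u)) = y • u)
    (hv : star (kAut q (star v)) = y • v) (w : ℕ → Coord q) :
    lowering q ∘ stepRow q u v w =
      y • stepRow q u v (lowering q ∘ w) + stepRow q (lowering q u) (lowering q v) w := by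
  ext (_ | i) <;>
    simp only [stepRow, Function.comp_apply, Pi.add_apply, Pi.smul_apply, map_add, map_smul,
      lowering_mul, hu, hv, mul_smul_comm, smul_add]
  module

theorem haar_deriv_mul_star (f g : Coord q) :
    haar q (deriv q f * star g) = -haar q (kAut q f * star (lowering q g)) := by
  rw [eq_neg_iff_add_eq_zero, add_comm, lowering_apply, star_star, ← map_add, ← deriv_mul,
    haar_deriv]

theorem haar_mul_star_comm (f g : Coord q) :
    haar q (g * star f) = conj (haar q (f * star g)) := by
  rw [← haar_star, star_mul, star_star]

end Lowering

section RowCoef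
variable (q : Param)

theorem rowCoef_zero_zero : rowCoef q 0 0 = Pi.single 0 1 := rfl

theorem rowCoef_succ_right (k j : ℕ) :
    rowCoef q k (j + 1) = stepRow q (gen q .b) (gen q .d) (rowCoef q k j) :=
  Function.iterate_succ_apply' _ _ _

theorem rowCoef_succ_left (k : ℕ) :
    rowCoef q (k + 1) 0 = stepRow q (gen q .a) (gen q .c) (rowCoef q k 0) :=
  Function.iterate_succ_apply' _ _ _

theorem comp_rowCoef_zero_zero {D : Coord q →ₗ[ℂ] Coord q} (hD : D 1 = 0) :
    D ∘ rowCoef q 0 0 = 0 := by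
  ext (_ | i)
  · simp [rowCoef_zero_zero, hD]
  · simp [rowCoef_zero_zero]

theorem stepRow_ac_rowCoef (k j : ℕ) :
    stepRow q (gen q .a) (gen q .c) (rowCoef q k j) =
      ((q : ℝ) : ℂ)⁻¹ ^ j • rowCoef q (k + 1) j := by
  induction j with
  | zero => rw [← rowCoef_succ_left, pow_zero, one_smul]
  | succ j ih =>
    rw [rowCoef_succ_right, stepRow_ac_stepRow_bd, ih, stepRow_smul, smul_smul, ← pow_succ',
      rowCoef_succ_right]

theorem kAut_comp_rowCoef (k j : ℕ) : kAut q ∘ rowCoef q k j =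
    (((q : ℝ) : ℂ) ^ k * ((q : ℝ) : ℂ)⁻¹ ^ j) • rowCoef q k j := by
  obtain ⟨ka, kb, kc, kd⟩ := kAut_gen q
  induction j with
  | zero =>
    induction k with
    | zero => ext (_ | i) <;> simp [rowCoef_zero_zero]
    | succ k ih => rw [rowCoef_succ_left, kAut_comp_stepRow q ka kc ih, pow_succ]; ring_nf
  | succ j ih => rw [rowCoef_succ_right, kAut_comp_stepRow q kb kd ih, pow_succ, mul_assoc]

theorem num_zero : num q 0 = 0 := rfl

theorem num_succ (k : ℕ) : num q (k + 1) = (q : ℝ) * num q k + (q : ℝ)⁻¹ ^ k := rfl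

theorem num_succ' (k : ℕ) : num q (k + 1) = (q : ℝ) ^ k + (q : ℝ)⁻¹ * num q k := by
  induction k with
  | zero => simp [num]
  | succ k ih =>
    linear_combination num_succ q (k + 1) + (q : ℝ) * ih - (q : ℝ)⁻¹ * num_succ q k

theorem deriv_comp_rowCoef (k j : ℕ) : deriv q ∘ rowCoef q k j =
    (num q k : ℂ) • rowCoef q (k - 1) (j + 1) := by
  obtain ⟨ea, eb, ec, ed⟩ := deriv_gen q
  induction j with
  | zero =>
    induction k with
    | zero => rw [comp_rowCoef_zero_zero q (deriv_one q), num_zero, Complex.ofReal_zero, zero_smul]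
    | succ k ih =>
      rw [rowCoef_succ_left, deriv_comp_stepRow q _ _ (kAut_comp_rowCoef q k 0), ea, ec,
        ← rowCoef_succ_right, ih, stepRow_smul, stepRow_ac_rowCoef, num_succ', Nat.add_sub_cancel]
      rcases k with _ | k
      · simp [num_zero]
      · rw [Nat.add_sub_cancel]
        push_cast
        module
  | succ j ih =>
    rw [rowCoef_succ_right, deriv_comp_stepRow q _ _ (kAut_comp_rowCoef q k j), eb, ed,
      stepRow_zero_zero, smul_zero, zero_add, ih, stepRow_smul, ← rowCoef_succ_right]

theorem lowering_comp_rowCoef (k j : ℕ) : lowering q ∘ rowCoef q k j =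
    (-((q : ℝ) : ℂ) * num q j) • rowCoef q (k + 1) (j - 1) := by
  obtain ⟨fa, fb, fc, fd⟩ := lowering_gen q
  obtain ⟨ka, kb, kc, kd⟩ := star_kAut_star_gen q
  induction j with
  | zero =>
    rw [num_zero, Complex.ofReal_zero, mul_zero, zero_smul]
    induction k with
    | zero => exact comp_rowCoef_zero_zero q (lowering_one q)
    | succ k ih =>
      rw [rowCoef_succ_left, lowering_comp_stepRow q ka kc, ih, stepRow_zero_right, fa, fc,
        stepRow_zero_zero, smul_zero, zero_add]
  | succ j ih =>
    rw [rowCoef_succ_right, lowering_comp_stepRow q kb kd, ih, fb, fd, stepRow_smul,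
      stepRow_smul_smul, stepRow_ac_rowCoef, ← rowCoef_succ_right, num_succ, Nat.add_sub_cancel]
    rcases j with _ | j
    · simp [num_zero]
    · rw [Nat.add_sub_cancel]
      push_cast
      module

end RowCoef

section GaussBinom

theorem gaussBinom_succ {p : ℝ} {k : ℕ} (hp : p ^ (k + 1) ≠ 1) (n : ℕ) :
    gaussBinom p n (k + 1) * (1 - p ^ (k + 1)) = gaussBinom p n k * (1 - p ^ (n - k)) := by
  rw [gaussBinom, Finset.prod_range_succ, mul_assoc, div_mul_cancel₀ _ (sub_ne_zero.2 hp.symm),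
    gaussBinom]

theorem gaussBinom_succ_succ {p : ℝ} {k : ℕ} (hp : p ^ (k + 1) ≠ 1) (n : ℕ) :
    gaussBinom p (n + 1) (k + 1) * (1 - p ^ (k + 1)) = gaussBinom p n k * (1 - p ^ (n + 1)) := by
  have h : 1 - p ^ (k + 1) ≠ 0 := sub_ne_zero.2 hp.symm
  rw [gaussBinom, gaussBinom, Finset.prod_div_distrib, Finset.prod_div_distrib,
    Finset.prod_range_succ', Finset.prod_range_succ _ k]
  simp only [Nat.add_sub_add_right, Nat.sub_zero]
  field_simp

theorem gaussBinom_eq_zero (p : ℝ) {n k : ℕ} (h : n < k) : gaussBinom p n k = 0 :=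
  Finset.prod_eq_zero (Finset.mem_range.2 h) (by simp)

theorem gaussBinom_pascal {p : ℝ} {k : ℕ} (hp : p ^ (k + 1) ≠ 1) (n : ℕ) :
    gaussBinom p (n + 1) (k + 1) = p ^ (k + 1) * gaussBinom p n (k + 1) + gaussBinom p n k := by
  rcases lt_or_ge n k with hk | hk
  · rw [gaussBinom_eq_zero p hk, gaussBinom_eq_zero p (by omega : n < k + 1),
      gaussBinom_eq_zero p (by omega : n + 1 < k + 1), mul_zero, add_zero]
  · have h : p ^ (n + 1) = p ^ (k + 1) * p ^ (n - k) := by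
      rw [← pow_add]
      congr 1
      omega
    refine mul_right_cancel₀ (sub_ne_zero.2 hp.symm) ?_
    linear_combination gaussBinom_succ_succ hp n - p ^ (k + 1) * gaussBinom_succ hp n -
      gaussBinom p n k * h

theorem gaussBinom_self {p : ℝ} (hp : ∀ k, p ^ (k + 1) ≠ 1) (n : ℕ) : gaussBinom p n n = 1 := by
  induction n with
  | zero => simp [gaussBinom]
  | succ n ih =>
    refine mul_right_cancel₀ (sub_ne_zero.2 (hp n).symm) ?_
    rw [gaussBinom_succ_succ (hp n) n, ih]

variable (q : Param)

theorem inv_sq_pow_ne_one (k : ℕ) : ((q : ℝ) ^ 2)⁻¹ ^ (k + 1) ≠ 1 :=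
  (one_lt_pow₀ ((one_lt_inv₀ (pow_pos q.2.1 _)).2 (pow_lt_one₀ q.2.1.le q.2.2 two_ne_zero))
    k.succ_ne_zero).ne'

theorem one_sub_inv_sq_pow (k : ℕ) :
    1 - ((q : ℝ) ^ 2)⁻¹ ^ (k + 1) = ((q : ℝ) ^ 2 - 1) * num q (k + 1) / (q : ℝ) ^ (k + 2) := by
  have h0 : (q : ℝ) ≠ 0 := q.2.1.ne'
  rw [eq_div_iff (pow_ne_zero _ h0)]
  refine mul_left_cancel₀ (pow_ne_zero k h0) ?_
  have hcancel : ((q : ℝ) ^ 2)⁻¹ ^ (k + 1) * ((q : ℝ) ^ 2) ^ (k + 1) = 1 := by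
    rw [← mul_pow, inv_mul_cancel₀ (pow_ne_zero 2 h0), one_pow]
  linear_combination -hcancel - num_eq q k

theorem gaussBinom_succ_mul_num (m k : ℕ) :
    gaussBinom ((q : ℝ) ^ 2)⁻¹ (m + k + 1) (k + 1) * ((q : ℝ) ^ m * num q (k + 1)) =
      gaussBinom ((q : ℝ) ^ 2)⁻¹ (m + k + 1) k * ((q : ℝ) ^ k * num q (m + 1)) := by
  have h0 : (q : ℝ) ≠ 0 := q.2.1.ne'
  have hq : (q : ℝ) ^ 2 - 1 ≠ 0 := (sub_neg.2 (pow_lt_one₀ q.2.1.le q.2.2 two_ne_zero)).ne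
  have h := gaussBinom_succ (inv_sq_pow_ne_one q k) (m + k + 1)
  rw [show m + k + 1 - k = m + 1 by omega, one_sub_inv_sq_pow, one_sub_inv_sq_pow, mul_div_assoc',
    mul_div_assoc', div_eq_div_iff (pow_ne_zero _ h0) (pow_ne_zero _ h0)] at h
  refine mul_left_cancel₀ (mul_ne_zero (pow_ne_zero 2 h0) hq) ?_
  linear_combination h

theorem normalizer_mul_self {n k : ℕ} (hk : k ≤ n) :
    normalizer q n k * normalizer q n k = gaussBinom ((q : ℝ) ^ 2)⁻¹ n k :=
  Real.mul_self_sqrt (Real.sqrt_pos.1 (normalizer_pos q hk)).le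

end GaussBinom

section Orthogonality
variable (q : Param)

theorem rowCoef_zero_right (k i : ℕ) : rowCoef q k 0 i =
    (gaussBinom ((q : ℝ) ^ 2)⁻¹ k i : ℂ) • (gen q .a ^ (k - i) * gen q .c ^ i) := by
  induction k generalizing i with
  | zero =>
    rcases i with _ | i
    · simp [rowCoef_zero_zero, gaussBinom]
    · simp [rowCoef_zero_zero, gaussBinom_eq_zero]
  | succ k ih =>
    rw [rowCoef_succ_left]
    rcases i with _ | i
    · simp [stepRow, ih, gaussBinom, pow_succ]
    · have hca : (gen q .a ^ (k - (i + 1)) * gen q .c ^ (i + 1)) * gen q .a =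
          ((q : ℝ) : ℂ)⁻¹ ^ (i + 1) • (gen q .a ^ (k - (i + 1) + 1) * gen q .c ^ (i + 1)) := by
        rw [mul_assoc, pow_gen_ca, mul_smul_comm, ← mul_assoc, ← pow_succ]
      rw [stepRow, ih, ih, smul_mul_assoc, smul_mul_assoc, hca, mul_assoc _ _ (gen q .c),
        ← pow_succ, gaussBinom_pascal (inv_sq_pow_ne_one q i), Nat.add_sub_add_right]
      rcases lt_or_ge k (i + 1) with h | h
      · simp [gaussBinom_eq_zero _ h]
      · rw [show k - (i + 1) + 1 = k - i by omega]
        match_scalars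
        ring

theorem haar_mon_zero_diag (n : ℕ) : (-((q : ℝ) : ℂ)⁻¹) ^ n * haar q (mon q 0 n n 0) =
    (((q : ℝ) : ℂ) ^ n * num q (n + 1))⁻¹ := by
  have h0 := Param.ne_zero q
  have hterm (r : ℕ) : ((q : ℝ) : ℂ) ^ (2 * r) * entry q (mon q 0 n n 0) (r, 0) (r, 0) =
      (-((q : ℝ) : ℂ)) ^ n * (((q : ℝ) : ℂ) ^ (2 * n + 2)) ^ r := by
    rw [entry_mon, qprod, Finset.prod_range_zero, neg_pow ((q : ℝ) : ℂ)]
    ring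
  have hlt : ‖((q : ℝ) : ℂ) ^ (2 * n + 2)‖ < 1 := by
    rw [norm_pow, norm_q]
    exact pow_lt_one₀ q.2.1.le q.2.2 (by omega)
  have hne : 1 - ((q : ℝ) : ℂ) ^ (2 * n + 2) ≠ 0 :=
    sub_ne_zero.2 fun h => hlt.ne (by rw [← h, norm_one])
  have hnum : (((q : ℝ) : ℂ) ^ 2 - 1) * ((q : ℝ) : ℂ) ^ n * num q (n + 1) =
      ((q : ℝ) : ℂ) ^ (2 * n + 2) - 1 := mod_cast num_eq q n
  have hsign : (-((q : ℝ) : ℂ)⁻¹) ^ n * (-((q : ℝ) : ℂ)) ^ n = 1 := by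
    rw [← mul_pow, neg_mul_neg, inv_mul_cancel₀ h0, one_pow]
  rw [haar_apply]
  simp only [hterm]
  rw [tsum_mul_left, tsum_geometric_of_norm_lt_one hlt, mul_left_comm, ← mul_assoc (_ ^ n),
    hsign, one_mul, ← div_eq_mul_inv, div_eq_iff hne,
    eq_inv_mul_iff_mul_eq₀ (mul_ne_zero (pow_ne_zero _ h0) (num_ne_zero q n))]
  linear_combination -hnum

theorem haar_mon_diag (m k : ℕ) :
    gaussBinom ((q : ℝ) ^ 2)⁻¹ (m + k) k *
        ((-((q : ℝ) : ℂ)⁻¹) ^ k * haar q (mon q m k k m)) =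
      (((q : ℝ) : ℂ) ^ (m + k) * num q (m + k + 1))⁻¹ := by
  induction m generalizing k with
  | zero =>
    rw [zero_add, gaussBinom_self (inv_sq_pow_ne_one q), Complex.ofReal_one, one_mul,
      haar_mon_zero_diag]
  | succ m ih =>
    have haux := haar_deriv_aux q k m
    have hgauss := congrArg Complex.ofReal (gaussBinom_succ_mul_num q m k)
    have hcancel : ((q : ℝ) : ℂ)⁻¹ * (q : ℝ) = 1 := inv_mul_cancel₀ (Param.ne_zero q)
    have hcancel_pow : ((q : ℝ) : ℂ)⁻¹ ^ k * ((q : ℝ) : ℂ) ^ k = 1 := by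
      rw [← mul_pow, hcancel, one_pow]
    rw [show m + 1 + k = m + (k + 1) by omega, ← ih (k + 1)]
    refine mul_left_cancel₀ (num_ne_zero q m) ?_
    rw [add_assoc m k 1] at hgauss
    set g₀ := gaussBinom ((q : ℝ) ^ 2)⁻¹ (m + (k + 1)) k
    set g₁ := gaussBinom ((q : ℝ) ^ 2)⁻¹ (m + (k + 1)) (k + 1)
    set H₀ := haar q (mon q (m + 1) k k (m + 1))
    set Q : ℂ := ((q : ℝ) : ℂ)
    push_cast at hgauss
    linear_combination (-Q⁻¹) ^ k * (g₁ * Q⁻¹ * haux - g₁ * Q ^ m * Q⁻¹ ^ k * num q (k + 1) * H₀ *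
      hcancel - Q⁻¹ ^ k * H₀ * hgauss - num q (m + 1) * g₀ * H₀ * hcancel_pow)

theorem haar_rowCoef_zero_right_mul_star (k i k' i' : ℕ) :
    haar q (rowCoef q k 0 i * star (rowCoef q k' 0 i')) =
      gaussBinom ((q : ℝ) ^ 2)⁻¹ k i * gaussBinom ((q : ℝ) ^ 2)⁻¹ k' i' *
        ((-((q : ℝ) : ℂ)⁻¹) ^ i' * haar q (mon q (k - i) i i' (k' - i'))) := by
  rw [rowCoef_zero_right, rowCoef_zero_right, star_smul', Complex.conj_ofReal, star_mul,
    star_pow, star_pow, star_gen, star_gen, smul_mul_smul_comm, map_smul, smul_eq_mul]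
  simp only [genStar]
  rw [smul_pow, smul_mul_assoc, mul_smul_comm, map_smul, smul_eq_mul, mon]
  simp only [mul_assoc]

/- Since `h ∘ E = 0`, lowering the second factor undoes raising the first one. -/
theorem haar_rowCoef_succ_mul_star (k j i k' j' i' : ℕ) :
    (num q (k + 1) : ℂ) * haar q (rowCoef q k (j + 1) i * star (rowCoef q k' j' i')) =
      ((q : ℝ) : ℂ) ^ (k + 2) * ((q : ℝ) : ℂ)⁻¹ ^ j * num q j' *
        haar q (rowCoef q (k + 1) j i * star (rowCoef q (k' + 1) (j' - 1) i')) := by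
  have hE : deriv q (rowCoef q (k + 1) j i) = _ := congrFun (deriv_comp_rowCoef q (k + 1) j) i
  have hK : kAut q (rowCoef q (k + 1) j i) = _ := congrFun (kAut_comp_rowCoef q (k + 1) j) i
  have hF : lowering q (rowCoef q k' j' i') = _ := congrFun (lowering_comp_rowCoef q k' j') i'
  have h := haar_deriv_mul_star q (rowCoef q (k + 1) j i) (rowCoef q k' j' i')
  simp only [hE, hK, hF, Pi.smul_apply, star_smul', smul_mul_assoc, mul_smul_comm, map_smul,
    smul_eq_mul, map_mul, map_neg, Complex.conj_ofReal, Nat.add_sub_cancel] at h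
  linear_combination h

theorem haar_rowCoef_mul_star_of_ne {k j i k' j' i' : ℕ} (hi : i ≤ k + j) (hi' : i' ≤ k' + j')
    (h : ¬ (k = k' ∧ j = j' ∧ i = i')) :
    haar q (rowCoef q k j i * star (rowCoef q k' j' i')) = 0 := by
  have right_zero (k j i k' i' : ℕ) :
      haar q (rowCoef q k (j + 1) i * star (rowCoef q k' 0 i')) = 0 := by
    have := haar_rowCoef_succ_mul_star q k j i k' 0 i'
    rw [num_zero, Complex.ofReal_zero, mul_zero, zero_mul] at this
    exact (mul_eq_zero.1 this).resolve_left (num_ne_zero q k)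
  induction j generalizing k k' j' with
  | zero =>
    rcases j' with _ | j'
    · rw [haar_rowCoef_zero_right_mul_star, haar_mon_eq_zero q (by omega), mul_zero, mul_zero]
    · rw [haar_mul_star_comm, right_zero, map_zero]
  | succ j ih =>
    rcases j' with _ | j'
    · exact right_zero _ _ _ _ _
    · have := haar_rowCoef_succ_mul_star q k j i k' (j' + 1) i'
      rw [Nat.add_sub_cancel, ih (by omega) (by omega) (by omega), mul_zero] at this
      exact (mul_eq_zero.1 this).resolve_left (num_ne_zero q k)

theorem haar_rowCoef_mul_star_self {k j i : ℕ} (hi : i ≤ k + j) :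
    gaussBinom ((q : ℝ) ^ 2)⁻¹ (k + j) j * haar q (rowCoef q k j i * star (rowCoef q k j i)) =
      gaussBinom ((q : ℝ) ^ 2)⁻¹ (k + j) i * (((q : ℝ) : ℂ) ^ (2 * j) *
        (((q : ℝ) : ℂ) ^ (k + j) * num q (k + j + 1))⁻¹) := by
  induction j generalizing k with
  | zero =>
    obtain ⟨m, rfl⟩ := Nat.exists_eq_add_of_le' hi
    rw [add_zero, haar_rowCoef_zero_right_mul_star, Nat.add_sub_cancel, mul_assoc, haar_mon_diag]
    simp [gaussBinom]
  | succ j ih =>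
    have hstep := haar_rowCoef_succ_mul_star q k j i k (j + 1) i
    have hgauss := congrArg Complex.ofReal (gaussBinom_succ_mul_num q k j)
    have ih := ih (k := k + 1) (by omega)
    have hcancel_pow : ((q : ℝ) : ℂ)⁻¹ ^ j * ((q : ℝ) : ℂ) ^ j = 1 := by
      rw [← mul_pow, inv_mul_cancel₀ (Param.ne_zero q), one_pow]
    rw [Nat.add_sub_cancel] at hstep
    rw [show k + 1 + j = k + (j + 1) by omega] at ih
    rw [add_assoc k j 1] at hgauss
    refine mul_left_cancel₀ (num_ne_zero q k) ?_
    set g₀ := gaussBinom ((q : ℝ) ^ 2)⁻¹ (k + (j + 1)) j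
    set g₁ := gaussBinom ((q : ℝ) ^ 2)⁻¹ (k + (j + 1)) (j + 1)
    set I₀ := haar q (rowCoef q (k + 1) j i * star (rowCoef q (k + 1) j i))
    set Q : ℂ := ((q : ℝ) : ℂ)
    push_cast at hgauss
    linear_combination g₁ * hstep + Q ^ 2 * Q⁻¹ ^ j * I₀ * hgauss +
      Q ^ 2 * num q (k + 1) * g₀ * I₀ * hcancel_pow + Q ^ 2 * num q (k + 1) * ih

theorem haar_matCoef_mul_star_of_ne {n n' : ℕ} {i j : Fin (n + 1)} {i' j' : Fin (n' + 1)}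
    (h : ¬ (n = n' ∧ (i : ℕ) = i' ∧ (j : ℕ) = j')) :
    haar q (matCoef q n i j * star (matCoef q n' i' j')) = 0 := by
  rw [matCoef, matCoef, star_smul', smul_mul_smul_comm, map_smul,
    haar_rowCoef_mul_star_of_ne q (by omega) (by omega) (by omega), smul_zero]

theorem haar_matCoef_mul_star_self (n : ℕ) (i j : Fin (n + 1)) :
    haar q (matCoef q n i j * star (matCoef q n i j)) =
      ((q : ℝ) : ℂ) ^ (2 * (j : ℕ)) * (((q : ℝ) : ℂ) ^ n * num q (n + 1))⁻¹ := by
  have hj := Nat.lt_succ_iff.1 j.2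
  have hi := Nat.lt_succ_iff.1 i.2
  have hi0 : (normalizer q n i : ℂ) ≠ 0 := mod_cast (normalizer_pos q hi).ne'
  have h := haar_rowCoef_mul_star_self q (k := n - j) (j := j) (i := i) (by omega)
  rw [Nat.sub_add_cancel hj, ← normalizer_mul_self q hi, ← normalizer_mul_self q hj] at h
  rw [matCoef, star_smul', Complex.conj_ofReal, smul_mul_smul_comm, map_smul, smul_eq_mul]
  refine mul_left_cancel₀ (mul_ne_zero hi0 hi0) ?_
  push_cast at h ⊢
  rw [← h]
  field_simp

end Orthogonality

section FourierInversion
variable (q : Param)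

theorem qNumber_eq_num (n : ℕ) : qNumber q n = num q n := by
  have hne : (q : ℝ) - (q : ℝ)⁻¹ ≠ 0 :=
    (sub_neg.2 (q.2.2.trans ((one_lt_inv₀ q.2.1).2 q.2.2))).ne
  rw [qNumber, Complex.ofReal_inj, div_eq_iff hne]
  induction n with
  | zero => simp [num_zero]
  | succ n ih =>
    rw [num_succ]
    linear_combination (q : ℝ) * ih

/-- The inverse Fourier transform of a matrix placed in degree `l`, `n = 2l`:
`A ↦ [2l+1]_q Tr_q(A T^(l))`. -/
noncomputable def invFourier (n : ℕ) : Matrix (Fin (n + 1)) (Fin (n + 1)) (Coord q) →ₗ[ℂ] L2 q :=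
  toL2 q ∘ₗ (qNumber q (n + 1) • qTrace q n ∘ₗ LinearMap.mulRight ℂ (Matrix.of (matCoef q n)))

/-- The Peter–Weyl component of degree `l` of `H`, parametrized by scalar matrices of size
`2l + 1` through the inverse Fourier transform. -/
noncomputable def peterWeyl (n : ℕ) : Matrix (Fin (n + 1)) (Fin (n + 1)) ℂ →ₗ[ℂ] L2 q :=
  invFourier q n ∘ₗ (Algebra.linearMap ℂ (Coord q)).mapMatrix

theorem peterWeyl_apply (n : ℕ) (A : Matrix (Fin (n + 1)) (Fin (n + 1)) ℂ) :
    peterWeyl q n A = invFourier q n (A.map (algebraMap ℂ (Coord q))) := rfl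

theorem qTrace_apply (n : ℕ) (A : Matrix (Fin (n + 1)) (Fin (n + 1)) (Coord q)) :
    qTrace q n A = ∑ j : Fin (n + 1), ((q : ℝ) : ℂ) ^ ((n : ℤ) - 2 * (j : ℕ)) • A j j := rfl

theorem peterWeyl_single (n : ℕ) (j k : Fin (n + 1)) :
    peterWeyl q n (Matrix.single j k 1) =
      (qNumber q (n + 1) * ((q : ℝ) : ℂ) ^ ((n : ℤ) - 2 * (j : ℕ))) •
        toL2 q (matCoef q n k j) := by
  have htrace : qTrace q n (Matrix.single j k 1 * Matrix.of (matCoef q n)) =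
      ((q : ℝ) : ℂ) ^ ((n : ℤ) - 2 * (j : ℕ)) • matCoef q n k j := by
    rw [qTrace_apply, Finset.sum_eq_single j, Matrix.single_mul_apply_same, one_mul,
      Matrix.of_apply]
    · intro i _ hi
      rw [Matrix.single_mul_apply_of_ne _ _ _ _ _ hi, smul_zero]
    · simp
  rw [peterWeyl_apply, Matrix.map_single, map_one, mul_smul, ← map_smul, ← htrace, ← map_smul]
  rfl

theorem fourier_peterWeyl (n : ℕ) (A : Matrix (Fin (n + 1)) (Fin (n + 1)) ℂ) :
    fourier q n (peterWeyl q n A) = A := by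
  suffices fourier q n ∘ₗ peterWeyl q n = LinearMap.id from LinearMap.congr_fun this A
  refine Matrix.ext_linearMap ℂ fun j k => LinearMap.ext_ring ?_
  ext r s
  have h0 := Param.ne_zero q
  simp only [LinearMap.comp_apply, Matrix.singleLinearMap_apply, LinearMap.id_apply,
    peterWeyl_single, map_smul, Matrix.smul_apply, fourier_toL2, smul_eq_mul]
  by_cases h : j = r ∧ k = s
  · obtain ⟨rfl, rfl⟩ := h
    have hnum := num_ne_zero q n
    rw [haar_matCoef_mul_star_self, Matrix.single_apply_same, qNumber_eq_num, zpow_sub₀ h0]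
    simp only [← Nat.cast_ofNat (R := ℤ), ← Nat.cast_mul, zpow_natCast]
    field_simp
  · rw [Matrix.single_apply_of_ne _ _ _ _ _ h, haar_matCoef_mul_star_of_ne q (by omega), mul_zero]

theorem fourier_peterWeyl_of_ne {n n' : ℕ} (h : n' ≠ n)
    (A : Matrix (Fin (n + 1)) (Fin (n + 1)) ℂ) : fourier q n' (peterWeyl q n A) = 0 := by
  suffices fourier q n' ∘ₗ peterWeyl q n = 0 from LinearMap.congr_fun this A
  refine Matrix.ext_linearMap ℂ fun j k => LinearMap.ext_ring ?_
  ext r s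
  simp only [LinearMap.comp_apply, Matrix.singleLinearMap_apply, peterWeyl_single, map_smul,
    Matrix.smul_apply, fourier_toL2, LinearMap.zero_apply]
  rw [haar_matCoef_mul_star_of_ne q (by omega), smul_zero, Matrix.zero_apply]

theorem peterWeyl_injective (n : ℕ) : Function.Injective (peterWeyl q n) :=
  Function.LeftInverse.injective (fourier_peterWeyl q n)

end FourierInversion

section Eigenspaces

theorem hasSum_symbolTerm_peterWeyl {q : Param} (σ : Symbol q) (n : ℕ)
    (A : Matrix (Fin (n + 1)) (Fin (n + 1)) ℂ) :
    HasSum (symbolTerm σ (peterWeyl q n A))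
      (invFourier q n (σ n * A.map (algebraMap ℂ (Coord q)))) := by
  have hself : symbolTerm σ (peterWeyl q n A) n =
      invFourier q n (σ n * A.map (algebraMap ℂ (Coord q))) := by
    rw [symbolTerm, fourier_peterWeyl]
    rfl
  rw [← hself]
  refine hasSum_single n fun n' hn => ?_
  rw [symbolTerm, fourier_peterWeyl_of_ne q hn, Matrix.map_zero _ (map_zero _), Matrix.mul_zero,
    Matrix.zero_mul, map_zero, smul_zero, map_zero]

theorem peterWeyl_mem_pmapEigenspace {q : Param} (σ : Symbol q) {n : ℕ} {z : ℂ}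
    {A : Matrix (Fin (n + 1)) (Fin (n + 1)) ℂ}
    (hA : σ n * A.map (algebraMap ℂ (Coord q)) = z • A.map (algebraMap ℂ (Coord q))) :
    peterWeyl q n A ∈ pmapEigenspace (psiDO σ) z := by
  have h := hasSum_symbolTerm_peterWeyl σ n A
  rw [hA, map_smul, ← peterWeyl_apply] at h
  exact (mem_pmapEigenspace _ _ _).2 ⟨h.summable, h.tsum_eq⟩

theorem natCast_le_rank_pmapEigenspace_psiDO {q : Param} (σ : Symbol q) {n : ℕ} {z : ℂ}
    {v : Fin (n + 1) → ℂ} (hv : v ≠ 0)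
    (hσv : (σ n).mulVec (algebraMap ℂ (Coord q) ∘ v) = z • (algebraMap ℂ (Coord q) ∘ v)) :
    ((n + 1 : ℕ) : Cardinal) ≤ Module.rank ℂ (pmapEigenspace (psiDO σ) z) := by
  have hmem (w : Fin (n + 1) → ℂ) :
      peterWeyl q n (Matrix.vecMulVec v w) ∈ pmapEigenspace (psiDO σ) z := by
    have hmap : (Matrix.vecMulVec v w).map (algebraMap ℂ (Coord q)) =
        Matrix.vecMulVec (algebraMap ℂ (Coord q) ∘ v) (algebraMap ℂ (Coord q) ∘ w) :=
      Matrix.ext fun _ _ => map_mul (algebraMap ℂ (Coord q)) _ _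
    refine peterWeyl_mem_pmapEigenspace σ ?_
    rw [hmap, Matrix.mul_vecMulVec, hσv, Matrix.smul_vecMulVec]
  let φ := (peterWeyl q n ∘ₗ vecMulVecBilin ℂ ℂ v).codRestrict _ hmem
  have hφ : Function.Injective φ := by
    refine (injective_iff_map_eq_zero φ).2 fun w hw => ?_
    have hvw : Matrix.vecMulVec v w = 0 :=
      peterWeyl_injective q n ((congrArg Subtype.val hw).trans (map_zero _).symm)
    exact (Matrix.vecMulVec_eq_zero.1 hvw).resolve_left hv
  simpa using LinearMap.rank_le_of_injective φ hφ

theorem mem_pmapSpectrum_of_pmapEigenspace_ne_bot {H : Type*} [NormedAddCommGroup H]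
    [NormedSpace ℂ H] {T : H →ₗ.[ℂ] H} {z : ℂ} (hz : pmapEigenspace T z ≠ ⊥) :
    z ∈ pmapSpectrum T := by
  obtain ⟨f, hf, hf0⟩ := Submodule.exists_mem_ne_zero_of_ne_bot hz
  obtain ⟨hdom, hTf⟩ := (mem_pmapEigenspace T z f).1 hf
  rintro ⟨R, -, hR⟩
  have := hR ⟨f, hdom⟩
  rw [hTf, sub_self, map_zero] at this
  exact hf0 this.symm

end Eigenspaces

end SUq2

theorem mainTheorem7_general (q : SUq2.Param) (σ : SUq2.Symbol q) {n : ℕ} {z : ℂ}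
    {v : Fin (n + 1) → ℂ} (hv : v ≠ 0)
    (hσv : (σ n).mulVec (algebraMap ℂ (SUq2.Coord q) ∘ v) =
      z • (algebraMap ℂ (SUq2.Coord q) ∘ v)) :
    z ∈ SUq2.pmapSpectrum (SUq2.psiDO σ) ∧
      ((n + 1 : ℕ) : Cardinal) ≤ Module.rank ℂ (SUq2.pmapEigenspace (SUq2.psiDO σ) z) := by
  have hrank := SUq2.natCast_le_rank_pmapEigenspace_psiDO σ hv hσv
  refine ⟨SUq2.mem_pmapSpectrum_of_pmapEigenspace_ne_bot fun hbot => ?_, hrank⟩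
  rw [hbot, rank_bot] at hrank
  exact absurd hrank (by simp)

theorem mainTheorem7 (q : SUq2.Param) (lam : ℕ → ℂ) (σ : SUq2.Symbol q)
    (hσ : σ ∈ SUq2.symbolClass q 0)
    (hrow : ∀ (n : ℕ) (i₀ : Fin (n + 1)),
      ∑ j, σ n i₀ j = algebraMap ℂ (SUq2.Coord q) (lam n)) :
    Set.range lam ⊆ SUq2.pmapSpectrum (SUq2.psiDO σ) ∧
      ∀ n : ℕ, ((n + 1 : ℕ) : Cardinal) ≤
        Module.rank ℂ (SUq2.pmapEigenspace (SUq2.psiDO σ) (lam n)) := by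
  have h (n : ℕ) := mainTheorem7_general q σ (n := n) (z := lam n) (v := 1) one_ne_zero <| by
    ext i
    simp [Matrix.mulVec, dotProduct, hrow, Algebra.algebraMap_eq_smul_one]
  exact ⟨Set.range_subset_iff.2 fun n => (h n).1, fun n => (h n).2⟩
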